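/- Let $q$ be a prime power, $K_\infty=\mathbb F_q((1/\theta))$, and $\mathbb C_\infty$ the completion of an algebraic closure of $K_\infty$, with $|\theta|_\infty=q$. Let $\mathbb T_s$ be the Tate algebra of power series $\sum_\nu a_\nu \underline t^\nu$ in $t_1,\dots,t_s$ over $\mathbb C_\infty$ with $|a_\nu|_\infty\to 0$, equipped with the Gauss norm $\|\sum a_\nu\underline t^\nu\|_\infty=\sup_\nu|a_\nu|_\infty$ and the twist $\tau(\sum a_\nu\underline t^\nu)=\sum a_\nu^q\,\underline t^\nu$; write $f^{(n)}=\tau^n(f)$ for $n\in\mathbb Z$ and $\sigma=\tau^{-1}$; on power series in $z$ over $\mathbb T_s$ and on vectors of such, twists act on the coefficients. Let $\phi\colon \mathbb F_q[\theta,t_1,\dots,t_s]\to\mathbb T_s[\tau]$ be a Drinfeld module of rank $r\ge 1$, i.e. an $\mathbb F_q[t_1,\dots,t_s]$-algebra homomorphism with $$\phi_\theta=\theta+A_1\tau+\dots+A_r\tau^r,$$ and assume $A_r\in\mathbb T_s^\times$. Let $\exp_\phi=\sum_{i\ge0}\alpha_i\tau^i\in\mathbb T_s[[\tau]]$ be the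 unique series with $\alpha_0=1$ and $\exp_\phi a=\phi_a\exp_\phi$ for all $a\in\mathbb F_q[\theta,t_1,\dots,t_s]$, and put $\exp_\phi(f)=\sum_i\alpha_if^{(i)}$ for $f\in\mathbb T_s$. Let $\mathbb T_s[z]$ act on $\mathbb T_s[\sigma]$ by $cz^k\cdot m=c\,m\,(\phi_\theta^*)^k$ ($c\in\mathbb T_s$), where $\phi_\theta^*=\theta+A_1^{(-1)}\sigma+\dots+A_r^{(-r)}\sigma^r$. For $\mathbf h=[h_1,\dots,h_r]\in\mathrm{Mat}_{1\times r}(\mathbb T_s[z])$ put $\iota(\mathbf h)=h_1\cdot 1+h_2\cdot\sigma+\dots+h_r\cdot\sigma^{r-1}$, and let $\Phi\in\mathrm{Mat}_r(\mathbb T_s[z])$ be the matrix with $1$'s directly above the diagonal, last row $$\Bigl[\tfrac{z-\theta}{A_r^{(-r)}},\,-\tfrac{A_1^{(-1)}}{A_r^{(-r)}},\,\dots,\,-\tfrac{A_{r-1}^{(-r+1)}}{A_r^{(-r)}}\Bigr],$$ and zeros elsewhere. Put $\delta_0(\sum a_i\sigma^i)=a_0$ and $\delta_1(\sum a_i\sigma^i)=\sum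 a_i^{(i)}$. Let $\mathbb T_s\{z/\theta\}$ be the set of $\sum a_iz^i\in\mathbb T_s[[z]]$ with $q^i\|a_i\|_\infty\to0$, with norm $\sup_i q^i\|a_i\|_\infty$, and let $D_0\colon\mathrm{Mat}_{1\times r}(\mathbb T_s\{z/\theta\})\to\mathbb T_s$ be the extension by continuity of $\delta_0\circ\iota$ from the dense subset $\mathrm{Mat}_{1\times r}(\mathbb T_s[z])$. Let $\mathbf h\in\mathrm{Mat}_{1\times r}(\mathbb T_s[z])$ and let $\mathbf g\in\mathrm{Mat}_{1\times r}(\mathbb T_s\{z/\theta\})$ satisfy $$\mathbf g^{(-1)}\Phi-\mathbf g=\mathbf h .$$ Then, with $\xi=D_0(\mathbf g+\mathbf h)$ (the limit defining it exists), the series $\exp_\phi(\xi)$ converges and $$\exp_\phi\bigl(D_0(\mathbf g+\mathbf h)\bigr)=\delta_1(\iota(\mathbf h)).$$ -/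

import Mathlib

open Filter Topology
open scoped Polynomial

noncomputable section
namespace DrinfeldTate

/-! ## The field `ℂ_∞` -/
section Cinf
variable (F : Type*) [Field F] [Fintype F]

open Classical in
/-- The absolute value `|·|_∞` on `K = 𝔽_q(θ)`, normalized so that `|θ|_∞ = q`. -/
def inftyAbs : AbsoluteValue (RatFunc F) ℝ where
  toFun f := if f = 0 then 0 else (Fintype.card F : ℝ) ^ f.intDegree
  map_mul' f g := by
    have hq : (Fintype.card F : ℝ) ≠ 0 := by exact_mod_cast Fintype.card_ne_zero
    by_cases hf : f = 0
    · simp [hf]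
    by_cases hg : g = 0
    · simp [hg]
    simp [hf, hg, RatFunc.intDegree_mul hf hg, zpow_add₀ hq]
  nonneg' f := by
    split_ifs <;> positivity
  eq_zero' f := by
    have hq : (Fintype.card F : ℝ) ≠ 0 := by exact_mod_cast Fintype.card_ne_zero
    by_cases hf : f = 0 <;> simp [hf, zpow_ne_zero, hq]
  add_le' f g := by
    have hq : (1 : ℝ) ≤ Fintype.card F := by exact_mod_cast Fintype.card_pos
    have hq0 : (0 : ℝ) < Fintype.card F := by positivity
    by_cases hf : f = 0
    · simp only [hf, zero_add, if_true, le_refl]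
    by_cases hg : g = 0
    · simp only [hg, add_zero, if_true, le_refl]
    by_cases hfg : f + g = 0
    · simp only [hf, hg, hfg, if_true, if_false]; positivity
    simp only [hf, hg, hfg, if_false]
    have h1 := RatFunc.intDegree_add_le hg hfg
    rcases le_max_iff.1 h1 with h | h
    · have := zpow_le_zpow_right₀ hq h
      have h2 : 0 < (Fintype.card F : ℝ) ^ g.intDegree := by positivity
      linarith
    · have := zpow_le_zpow_right₀ hq h
      have h2 : 0 < (Fintype.card F : ℝ) ^ f.intDegree := by positivity
      linarith

theorem inftyAbs_isNonarchimedean : IsNonarchimedean (inftyAbs F) := by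
  intro f g
  have hq : (1 : ℝ) ≤ Fintype.card F := by exact_mod_cast Fintype.card_pos
  have hn := (inftyAbs F).nonneg
  by_cases hf : f = 0
  · simp [hf]
  by_cases hg : g = 0
  · simp [hg]
  by_cases hfg : f + g = 0
  · simp [hfg, hn]
  simp only [inftyAbs, AbsoluteValue.coe_mk, MulHom.coe_mk, hf, hg, hfg, if_false]
  rcases le_max_iff.1 (RatFunc.intDegree_add_le hg hfg) with h | h
  · exact le_max_of_le_left (zpow_le_zpow_right₀ hq h)
  · exact le_max_of_le_right (zpow_le_zpow_right₀ hq h)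

theorem inftyAbs_X : inftyAbs F RatFunc.X = Fintype.card F := by
  simp [inftyAbs, RatFunc.X_ne_zero]

/-- `K_∞ = 𝔽_q((1/θ))`, the completion of `K = 𝔽_q(θ)` at the infinite place. -/
abbrev KInf : Type _ := (inftyAbs F).Completion

/-- The embedding `K → K_∞`. -/
def toKInf : RatFunc F →+* KInf F :=
  UniformSpace.Completion.coeRingHom.comp (WithAbs.equiv (inftyAbs F)).symm.toRingHom

theorem norm_toKInf (f : RatFunc F) : ‖toKInf F f‖ = inftyAbs F f := by
  change ‖((WithAbs.toAbs (inftyAbs F) f : WithAbs (inftyAbs F)) : KInf F)‖ = _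
  rw [UniformSpace.Completion.norm_coe]
  rfl

instance : IsUltrametricDist (KInf F) := by
  refine IsUltrametricDist.isUltrametricDist_of_forall_norm_add_le_max_norm fun x y => ?_
  induction x, y using UniformSpace.Completion.induction_on₂ with
  | hp => exact isClosed_le (by fun_prop) (by fun_prop)
  | ih a b =>
    rw [← UniformSpace.Completion.coe_add]
    simp only [UniformSpace.Completion.norm_coe]
    exact inftyAbs_isNonarchimedean F a.ofAbs b.ofAbs

instance : NontriviallyNormedField (KInf F) where
  non_trivial := ⟨toKInf F RatFunc.X, by
    rw [norm_toKInf, inftyAbs_X]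
    exact_mod_cast Fintype.one_lt_card⟩

/-- An algebraic closure of `K_∞`, with the unique extension of `|·|_∞`. -/
abbrev KInfBar : Type _ := AlgebraicClosure (KInf F)

instance : NormedField (KInfBar F) := spectralNorm.normedField (KInf F) (KInfBar F)

instance : NormedAlgebra (KInf F) (KInfBar F) := spectralNorm.normedAlgebra _ _

instance : IsUltrametricDist (KInfBar F) :=
  IsUltrametricDist.isUltrametricDist_of_forall_norm_add_le_max_norm
    (isNonarchimedean_spectralNorm (K := KInf F) (L := KInfBar F))

instance : NontriviallyNormedField (KInfBar F) where
  non_trivial := by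
    obtain ⟨x, hx⟩ := NontriviallyNormedField.non_trivial (α := KInf F)
    exact ⟨algebraMap _ _ x, by rwa [norm_algebraMap']⟩

/-- `ℂ_∞`, the completion of an algebraic closure of `K_∞`. -/
def CInf : Type _ := UniformSpace.Completion (KInfBar F)

instance : NormedField (CInf F) := inferInstanceAs (NormedField (UniformSpace.Completion (KInfBar F)))

instance : CompleteSpace (CInf F) :=
  inferInstanceAs (CompleteSpace (UniformSpace.Completion (KInfBar F)))

instance : NormedAlgebra (KInf F) (CInf F) :=
  inferInstanceAs (NormedAlgebra (KInf F) (UniformSpace.Completion (KInfBar F)))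

instance : IsUltrametricDist (CInf F) := IsUltrametricDist.of_normedAlgebra (KInf F)

instance : NontriviallyNormedField (CInf F) where
  non_trivial := by
    obtain ⟨x, hx⟩ := NontriviallyNormedField.non_trivial (α := KInf F)
    exact ⟨algebraMap _ _ x, by rwa [norm_algebraMap']⟩

/-- The embedding `K → ℂ_∞`. -/
def toCInf : RatFunc F →+* CInf F := (algebraMap (KInf F) (CInf F)).comp (toKInf F)

theorem norm_toCInf (f : RatFunc F) : ‖toCInf F f‖ = inftyAbs F f := by
  simp [toCInf, norm_toKInf]

instance : Algebra F (CInf F) := ((toCInf F).comp (algebraMap F (RatFunc F))).toAlgebra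

theorem norm_pow_card_sub (a b : CInf F) :
    ‖a ^ Fintype.card F - b ^ Fintype.card F‖ = ‖a - b‖ ^ Fintype.card F := by
  have h := map_sub (FiniteField.frobeniusAlgHom F (CInf F)) a b
  simp only [FiniteField.frobeniusAlgHom_apply] at h
  rw [← h, norm_pow]

theorem pow_card_surjective : Function.Surjective fun a : CInf F => a ^ Fintype.card F := by
  have hind : IsUniformInducing fun a : CInf F => a ^ Fintype.card F := by
    refine Metric.isUniformInducing_iff.2 ⟨?_, fun δ hδ => ?_⟩
    · refine Metric.uniformContinuous_iff.2 fun ε hε => ?_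
      refine ⟨min ε 1, by positivity, fun a b hab => ?_⟩
      rw [dist_eq_norm, norm_pow_card_sub, ← dist_eq_norm]
      have h1 : dist a b < 1 := hab.trans_le (min_le_right _ _)
      exact (pow_le_of_le_one dist_nonneg h1.le Fintype.card_ne_zero).trans_lt
        (hab.trans_le (min_le_left _ _))
    · refine ⟨δ ^ Fintype.card F, by positivity, fun {a b} hab => ?_⟩
      rw [dist_eq_norm, norm_pow_card_sub, ← dist_eq_norm] at hab
      exact lt_of_pow_lt_pow_left₀ _ hδ.le hab
  have hcl := hind.isComplete_range.isClosed
  intro x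
  have hx : x ∈ closure (Set.range fun a : CInf F => a ^ Fintype.card F) := by
    refine closure_mono ?_ (UniformSpace.Completion.denseRange_coe (α := KInfBar F) x)
    rintro _ ⟨y, rfl⟩
    obtain ⟨z, rfl⟩ := IsAlgClosed.exists_pow_nat_eq y (n := Fintype.card F) Fintype.card_pos
    exact ⟨(z : UniformSpace.Completion (KInfBar F)), (map_pow
      (UniformSpace.Completion.coeRingHom (α := KInfBar F)) z _).symm⟩
  rwa [hcl.closure_eq] at hx

/-- The `q`-th power Frobenius automorphism `a ↦ a^q` of `ℂ_∞`. -/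
def frob : CInf F ≃+* CInf F :=
  RingEquiv.ofBijective (FiniteField.frobeniusAlgHom F (CInf F)).toRingHom
    ⟨RingHom.injective _, pow_card_surjective F⟩

theorem frob_apply (a : CInf F) : frob F a = a ^ Fintype.card F := rfl

end Cinf

/-! ## Tate algebras -/
section Tate
variable (F : Type*) [Field F] [Fintype F] (s : ℕ)

/-- The Tate algebra `𝕋_s`: power series in `t_1, …, t_s` over `ℂ_∞` whose coefficients tend to
zero. -/
def Tate : Type _ :=
  MvPowerSeries.IsRestricted.subring (R := CInf F) (σ := Fin s) fun _ => (1 : ℝ)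

instance : CommRing (Tate F s) :=
  inferInstanceAs (CommRing (MvPowerSeries.IsRestricted.subring (R := CInf F) (σ := Fin s)
    fun _ => (1 : ℝ)))

variable {F s}

/-- The coefficient `a_ν` of `f = ∑ a_ν t^ν`. -/
def Tate.coeff (ν : Fin s →₀ ℕ) : Tate F s →+ CInf F :=
  (MvPowerSeries.coeff (R := CInf F) ν).toAddMonoidHom.comp
    (MvPowerSeries.IsRestricted.subring (R := CInf F) (σ := Fin s) fun _ => (1 : ℝ)).subtype.toAddMonoidHom

theorem isRestricted_one_iff {f : MvPowerSeries (Fin s) (CInf F)} :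
    f ∈ MvPowerSeries.IsRestricted.subring (R := CInf F) (σ := Fin s) (fun _ => (1 : ℝ)) ↔
      Tendsto (fun ν => ‖MvPowerSeries.coeff ν f‖) cofinite (𝓝 0) := by
  change MvPowerSeries.IsRestricted _ _ ↔ _
  simp [MvPowerSeries.IsRestricted, Finsupp.prod]

theorem Tate.tendsto_coeff (f : Tate F s) : Tendsto (fun ν => ‖f.coeff ν‖) cofinite (𝓝 0) :=
  isRestricted_one_iff.1 f.2

theorem Tate.ext {f g : Tate F s} (h : ∀ ν, f.coeff ν = g.coeff ν) : f = g :=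
  Subtype.ext (MvPowerSeries.ext h)

theorem Tate.bddAbove (f : Tate F s) : BddAbove (Set.range fun ν => ‖f.coeff ν‖) := by
  have h := f.tendsto_coeff.eventually (gt_mem_nhds zero_lt_one)
  rw [eventually_cofinite] at h
  refine (BddAbove.union (h.image fun ν => ‖f.coeff ν‖).bddAbove (bddAbove_Iic (a := (1 : ℝ)))).mono
    ?_
  rintro _ ⟨ν, rfl⟩
  by_cases hν : ‖f.coeff ν‖ < 1
  · exact Or.inr hν.le
  · exact Or.inl ⟨ν, hν, rfl⟩

/-- `𝕋_s` with the Gauss norm `‖∑ a_ν t^ν‖_∞ = sup_ν |a_ν|_∞`. -/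
instance : NormedAddCommGroup (Tate F s) :=
  AddGroupNorm.toNormedAddCommGroup
    { toFun := fun f => ⨆ ν, ‖f.coeff ν‖
      map_zero' := by simp
      add_le' := fun f g => ciSup_le fun ν => by
        rw [map_add]
        exact (norm_add_le _ _).trans
          (add_le_add (le_ciSup f.bddAbove ν) (le_ciSup g.bddAbove ν))
      neg' := fun f => by simp
      eq_zero_of_map_eq_zero' := fun f hf => Tate.ext fun ν => by
        have h := le_ciSup f.bddAbove ν
        rw [map_zero, ← norm_le_zero_iff]
        exact h.trans hf.le }

theorem Tate.norm_def (f : Tate F s) : ‖f‖ = ⨆ ν, ‖f.coeff ν‖ := rfl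

/-- Scalars `ℂ_∞ → 𝕋_s`. -/
def Tate.const : CInf F →+* Tate F s :=
  MvPowerSeries.C.codRestrict _ fun a => MvPowerSeries.isRestricted_C _ a

theorem Tate.coeff_zero_const (a : CInf F) : (Tate.const a : Tate F s).coeff 0 = a := by
  change MvPowerSeries.coeff (0 : Fin s →₀ ℕ) (MvPowerSeries.C a) = a
  classical
  rw [MvPowerSeries.coeff_C, if_pos rfl]

/-- The variable `t_i` of `𝕋_s`. -/
def Tate.t (i : Fin s) : Tate F s :=
  ⟨MvPowerSeries.X i, MvPowerSeries.isRestricted_monomial _ _ _⟩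

variable (F s) in
/-- The element `θ` of `𝕋_s`. -/
def theta : Tate F s := Tate.const (toCInf F RatFunc.X)

variable (F s) in
/-- The inclusion `𝔽_q[t_1, …, t_s] → 𝕋_s`. -/
def polyToTate : MvPolynomial (Fin s) F →+* Tate F s :=
  MvPolynomial.eval₂Hom (Tate.const.comp (algebraMap F (CInf F))) Tate.t

variable (F s) in
/-- `A[t_1, …, t_s] = 𝔽_q[t_1, …, t_s][θ]`, with `θ` written as the variable `X`. -/
abbrev ATs : Type _ := (MvPolynomial (Fin s) F)[X]

variable (F s) in
/-- The inclusion `A[t_1, …, t_s] → 𝕋_s`. -/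
def atsToTate : ATs F s →+* Tate F s := Polynomial.eval₂RingHom (polyToTate F s) (theta F s)

variable (F s) in
/-- The twisting automorphism `τ (∑ a_ν t^ν) = ∑ a_ν^q t^ν` of `𝕋_s`. -/
def tau : RingAut (Tate F s) where
  toFun f := ⟨MvPowerSeries.map (frob F : CInf F →+* CInf F) f.1, isRestricted_one_iff.2 (by
    have h := f.tendsto_coeff.pow (Fintype.card F)
    rw [zero_pow Fintype.card_ne_zero] at h
    refine h.congr fun ν => ?_
    rw [← norm_pow]
    rfl)⟩
  invFun f := ⟨MvPowerSeries.map ((frob F).symm : CInf F →+* CInf F) f.1,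
    isRestricted_one_iff.2 (by
      have h := f.tendsto_coeff.rpow_const (p := (Fintype.card F : ℝ)⁻¹) (Or.inr (by positivity))
      rw [Real.zero_rpow (by simp)] at h
      refine h.congr fun ν => ?_
      change _ = ‖(frob F).symm (f.coeff ν)‖
      conv_lhs => rw [← (frob F).apply_symm_apply (f.coeff ν), frob_apply, norm_pow]
      exact Real.pow_rpow_inv_natCast (norm_nonneg _) Fintype.card_ne_zero)⟩
  left_inv f := Tate.ext fun ν => (frob F).symm_apply_apply (f.coeff ν)
  right_inv f := Tate.ext fun ν => (frob F).apply_symm_apply (f.coeff ν)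
  map_mul' f g := Subtype.ext (map_mul (MvPowerSeries.map _) f.1 g.1)
  map_add' f g := Subtype.ext (map_add (MvPowerSeries.map _) f.1 g.1)

theorem tau_coeff (f : Tate F s) (ν : Fin s →₀ ℕ) :
    (tau F s f).coeff ν = f.coeff ν ^ Fintype.card F := rfl

theorem tau_const (a : CInf F) :
    tau F s (Tate.const a) = Tate.const (a ^ Fintype.card F) := by
  refine Tate.ext fun ν => ?_
  change MvPowerSeries.coeff ν (MvPowerSeries.C a) ^ _ = MvPowerSeries.coeff ν (MvPowerSeries.C _)
  classical
  rw [MvPowerSeries.coeff_C, MvPowerSeries.coeff_C]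
  split_ifs
  · rfl
  · exact zero_pow Fintype.card_ne_zero

/-- The `n`-fold twist `f^{(n)} = τ^n f`, for `n ∈ ℤ`. -/
def twist (n : ℤ) : RingAut (Tate F s) := tau F s ^ n

/-- The elements of `𝔽_q[t_1, …, t_s]` are fixed by `τ`. -/
theorem tau_polyToTate (a : MvPolynomial (Fin s) F) :
    tau F s (polyToTate F s a) = polyToTate F s a := by
  have : (tau F s : Tate F s →+* Tate F s).comp (polyToTate F s) = polyToTate F s := by
    apply MvPolynomial.ringHom_ext
    · intro c
      simp only [RingHom.comp_apply, polyToTate, MvPolynomial.eval₂Hom_C]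
      exact (tau_const _).trans (by rw [← map_pow, FiniteField.pow_card])
    · intro i
      refine Tate.ext fun ν => ?_
      simp only [RingHom.comp_apply, polyToTate, MvPolynomial.eval₂Hom_X']
      change MvPowerSeries.coeff ν (MvPowerSeries.X i : MvPowerSeries (Fin s) (CInf F)) ^ _ =
        MvPowerSeries.coeff ν (MvPowerSeries.X i : MvPowerSeries (Fin s) (CInf F))
      classical
      rw [MvPowerSeries.coeff_X]
      split_ifs <;> simp
  exact RingHom.congr_fun this a

theorem tau_pow_polyToTate (n : ℕ) (a : MvPolynomial (Fin s) F) :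
    (tau F s ^ n) (polyToTate F s a) = polyToTate F s a := by
  induction n with
  | zero => rfl
  | succ n ih => rw [pow_succ, RingAut.mul_apply, tau_polyToTate, ih]

end Tate

/-! ## Twisted power series and twisted polynomials -/
section Twisted
variable {R : Type*} [CommRing R]

/-- The twisted power series ring `R[[σ]]` for an automorphism `σ` of `R`: series `∑ a_i σ^i` with
the rule `σ a = σ(a) σ`. -/
def TwSeries (_σ : RingAut R) : Type _ := ℕ → R

namespace TwSeries
variable {σ : RingAut R}

instance : AddCommGroup (TwSeries σ) := inferInstanceAs (AddCommGroup (ℕ → R))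

/-- The coefficient of `σ^n`. -/
def coeff (n : ℕ) : TwSeries σ →+ R := Pi.evalAddMonoidHom (fun _ : ℕ => R) n

@[ext] theorem ext {f g : TwSeries σ} (h : ∀ n, f.coeff n = g.coeff n) : f = g := funext h

/-- The series with given coefficients. -/
def mk (a : ℕ → R) : TwSeries σ := a

@[simp] theorem coeff_mk (a : ℕ → R) (n : ℕ) : (mk a : TwSeries σ).coeff n = a n := rfl

instance : One (TwSeries σ) := ⟨mk (Pi.single 0 1)⟩

instance : Mul (TwSeries σ) :=
  ⟨fun f g => mk fun n => ∑ p ∈ Finset.HasAntidiagonal.antidiagonal n, f.coeff p.1 * (σ ^ p.1) (g.coeff p.2)⟩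

theorem coeff_one (n : ℕ) : (1 : TwSeries σ).coeff n = if n = 0 then 1 else 0 := by
  change (Pi.single 0 1 : ℕ → R) n = _
  rw [Pi.single_apply]

theorem coeff_mul (f g : TwSeries σ) (n : ℕ) : (f * g).coeff n =
    ∑ p ∈ Finset.HasAntidiagonal.antidiagonal n, f.coeff p.1 * (σ ^ p.1) (g.coeff p.2) := rfl

instance : Ring (TwSeries σ) :=
  { (inferInstance : AddCommGroup (TwSeries σ)) with
    one_mul := fun f => by
      ext n
      rw [coeff_mul, Finset.sum_eq_single (0, n)]
      · simp [coeff_one]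
      · rintro ⟨i, j⟩ h hne
        have : i ≠ 0 := by
          rintro rfl
          simp_all
        simp [coeff_one, this]
      · simp
    mul_one := fun f => by
      ext n
      rw [coeff_mul, Finset.sum_eq_single (n, 0)]
      · simp [coeff_one]
      · rintro ⟨i, j⟩ h hne
        have : j ≠ 0 := by
          rintro rfl
          simp_all
        simp [coeff_one, this]
      · simp
    zero_mul := fun f => by ext n; simp [coeff_mul]
    mul_zero := fun f => by ext n; simp [coeff_mul]
    left_distrib := fun f g h => by
      ext n; simp [coeff_mul, mul_add, Finset.sum_add_distrib]
    right_distrib := fun f g h => by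
      ext n; simp [coeff_mul, add_mul, Finset.sum_add_distrib]
    mul_assoc := fun f g h => by
      ext n
      simp only [coeff_mul, Finset.sum_mul, Finset.mul_sum, map_sum, Finset.sum_sigma']
      apply Finset.sum_nbij' (fun ⟨⟨_i, j⟩, ⟨k, l⟩⟩ => ⟨(k, l + j), (l, j)⟩)
        (fun ⟨⟨i, _j⟩, ⟨k, l⟩⟩ => ⟨(i + k, l), (i, k)⟩)
      · rintro ⟨⟨i, j⟩, ⟨k, l⟩⟩ h
        simp only [Finset.mem_sigma, Finset.HasAntidiagonal.mem_antidiagonal] at h ⊢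
        exact ⟨by omega, trivial⟩
      · rintro ⟨⟨i, j⟩, ⟨k, l⟩⟩ h
        simp only [Finset.mem_sigma, Finset.HasAntidiagonal.mem_antidiagonal] at h ⊢
        exact ⟨by omega, trivial⟩
      · rintro ⟨⟨i, j⟩, ⟨k, l⟩⟩ h
        simp only [Finset.mem_sigma, Finset.HasAntidiagonal.mem_antidiagonal] at h
        obtain ⟨h1, rfl⟩ := h
        rfl
      · rintro ⟨⟨i, j⟩, ⟨k, l⟩⟩ h
        simp only [Finset.mem_sigma, Finset.HasAntidiagonal.mem_antidiagonal] at h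
        obtain ⟨h1, rfl⟩ := h
        rfl
      · rintro ⟨⟨i, j⟩, ⟨k, l⟩⟩ h
        simp only [Finset.mem_sigma, Finset.HasAntidiagonal.mem_antidiagonal] at h
        obtain ⟨h1, rfl⟩ := h
        simp only [map_mul, pow_add, RingAut.mul_apply, mul_assoc] }

variable (σ) in
/-- The twisted polynomial ring `R[σ]`: the series with finitely many nonzero coefficients. -/
def polySubring : Subring (TwSeries σ) where
  carrier := {f | ∃ N, ∀ n, N ≤ n → f.coeff n = 0}
  zero_mem' := ⟨0, fun n _ => rfl⟩
  one_mem' := ⟨1, fun n hn => by rw [coeff_one, if_neg (by omega)]⟩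
  add_mem' := by
    rintro f g ⟨N, hN⟩ ⟨M, hM⟩
    exact ⟨max N M, fun n hn => by
      rw [map_add, hN n (le_of_max_le_left hn), hM n (le_of_max_le_right hn), add_zero]⟩
  neg_mem' := by
    rintro f ⟨N, hN⟩
    exact ⟨N, fun n hn => by rw [map_neg, hN n hn, neg_zero]⟩
  mul_mem' := by
    rintro f g ⟨N, hN⟩ ⟨M, hM⟩
    refine ⟨N + M, fun n hn => ?_⟩
    rw [coeff_mul]
    refine Finset.sum_eq_zero fun p hp => ?_
    rw [Finset.HasAntidiagonal.mem_antidiagonal] at hp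
    rcases le_or_gt N p.1 with h | h
    · rw [hN _ h, zero_mul]
    · rw [hM p.2 (by omega), map_zero, mul_zero]

end TwSeries

/-- The twisted polynomial ring `R[σ]`. -/
abbrev TwPoly (σ : RingAut R) : Type _ := TwSeries.polySubring σ

namespace TwPoly
variable {σ : RingAut R}

variable (σ) in
/-- Constants `R → R[σ]`. -/
def const : R →+* TwPoly σ where
  toFun a := ⟨TwSeries.mk (Pi.single 0 a), 1, fun n hn => by
    rw [TwSeries.coeff_mk, Pi.single_eq_of_ne (by omega)]⟩
  map_zero' := Subtype.ext (Pi.single_zero (M := fun _ : ℕ => R) 0)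
  map_one' := rfl
  map_add' a b := Subtype.ext (Pi.single_add (f := fun _ : ℕ => R) 0 a b)
  map_mul' a b := Subtype.ext <| TwSeries.ext fun n => by
    change (TwSeries.mk (Pi.single 0 (a * b)) : TwSeries σ).coeff n =
      (TwSeries.mk (Pi.single 0 a) * TwSeries.mk (Pi.single 0 b) : TwSeries σ).coeff n
    rw [TwSeries.coeff_mul]
    simp only [TwSeries.coeff_mk]
    rw [Finset.sum_eq_single_of_mem (0, n) (by simp)]
    · rcases eq_or_ne n 0 with rfl | hn <;> simp [*]
    · rintro ⟨i, j⟩ h hne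
      have : i ≠ 0 := by
        rintro rfl
        simp_all
      simp [this]

variable (σ) in
/-- The element `σ` of `R[σ]`. -/
def gen : TwPoly σ := ⟨TwSeries.mk (Pi.single 1 1), 2, fun n hn => by
  rw [TwSeries.coeff_mk, Pi.single_eq_of_ne (by omega)]⟩

/-- The coefficient of `σ^n`. -/
def coeff (f : TwPoly σ) (n : ℕ) : R := f.1.coeff n

instance : Module R (TwPoly σ) := Module.compHom _ (const σ)

theorem smul_def (a : R) (f : TwPoly σ) : a • f = const σ a * f := rfl

theorem ext {f g : TwPoly σ} (h : ∀ n, f.coeff n = g.coeff n) : f = g :=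
  Subtype.ext (TwSeries.ext h)

@[simp] theorem coeff_const_mul (a : R) (f : TwSeries σ) (n : ℕ) :
    ((const σ a : TwSeries σ) * f).coeff n = a * f.coeff n := by
  rw [TwSeries.coeff_mul, Finset.sum_eq_single_of_mem (0, n) (by simp)]
  · change a * (σ ^ 0) _ = _
    simp
  · rintro ⟨i, j⟩ h hne
    have hi : i ≠ 0 := by
      rintro rfl
      simp_all
    have : (const σ a : TwSeries σ).coeff i = 0 := Pi.single_eq_of_ne (M := fun _ => R) hi a
    simp [this]

@[simp] theorem coeff_mul_const (a : R) (f : TwSeries σ) (n : ℕ) :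
    (f * (const σ a : TwSeries σ)).coeff n = f.coeff n * (σ ^ n) a := by
  rw [TwSeries.coeff_mul, Finset.sum_eq_single_of_mem (n, 0) (by simp)]
  · rfl
  · rintro ⟨i, j⟩ h hne
    have hi : j ≠ 0 := by
      rintro rfl
      simp_all
    have : (const σ a : TwSeries σ).coeff j = 0 := Pi.single_eq_of_ne (M := fun _ => R) hi a
    simp [this]

theorem coeff_gen_pow (j n : ℕ) : (gen σ ^ j).coeff n = if n = j then 1 else 0 := by
  induction j generalizing n with
  | zero => exact TwSeries.coeff_one n
  | succ j ih =>
    rw [pow_succ']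
    change ((gen σ).1 * (gen σ ^ j).1).coeff n = _
    rw [TwSeries.coeff_mul]
    have hg : ∀ i, (gen σ).1.coeff i = if i = 1 then 1 else 0 := fun i =>
      Pi.single_apply (M := R) 1 1 i
    have ih' : ∀ i, (gen σ ^ j).1.coeff i = if i = j then 1 else 0 := ih
    simp only [hg, ih']
    cases n with
    | zero => simp
    | succ n =>
      rw [Finset.sum_eq_single_of_mem (1, n) (by simp [add_comm])]
      · by_cases hn : n = j <;> simp [hn]
      · rintro ⟨i, k⟩ h hne
        have hi : i ≠ 1 := by
          rintro rfl
          simp only [Finset.HasAntidiagonal.mem_antidiagonal] at h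
          exact hne (Prod.ext rfl (by dsimp only; omega))
        simp [hi]

theorem coeff_smul (a : R) (f : TwPoly σ) (n : ℕ) : (a • f).coeff n = a * f.coeff n :=
  coeff_const_mul a f.1 n

theorem coeff_sum {κ : Type*} (t : Finset κ) (f : κ → TwPoly σ) (n : ℕ) :
    (∑ i ∈ t, f i).coeff n = ∑ i ∈ t, (f i).coeff n :=
  map_sum ((TwSeries.coeff n).comp (TwSeries.polySubring σ).subtype.toAddMonoidHom) f t

/-- Right multiplication by `b`, an `R`-linear endomorphism of `R[σ]`. -/
def rightMul (b : TwPoly σ) : Module.End R (TwPoly σ) where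
  toFun m := m * b
  map_add' m n := add_mul m n b
  map_smul' a m := by simp only [smul_def, mul_assoc, RingHom.id_apply]

end TwPoly
end Twisted

/-! ## Drinfeld modules over Tate algebras -/
section Drinfeld
variable (F : Type*) [Field F] [Fintype F] (s : ℕ)

/-- `𝕋_s[τ]` is an `𝔽_q[t_1, …, t_s]`-algebra. -/
instance : Algebra (MvPolynomial (Fin s) F) (TwPoly (tau F s)) :=
  RingHom.toAlgebra' ((TwPoly.const (tau F s)).comp (polyToTate F s)) fun c f =>
    Subtype.ext <| TwSeries.ext fun n => by
      change ((TwPoly.const (tau F s) (polyToTate F s c) : TwSeries (tau F s)) * f.1).coeff n =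
        (f.1 * (TwPoly.const (tau F s) (polyToTate F s c) : TwSeries (tau F s))).coeff n
      rw [TwPoly.coeff_const_mul, TwPoly.coeff_mul_const,
        tau_pow_polyToTate, mul_comm]

/-- A Drinfeld `A[t_1, …, t_s]`-module over `𝕋_s` of rank `r ≥ 1`: an `𝔽_q[t_1, …, t_s]`-algebra
homomorphism `φ : A[t_1, …, t_s] → 𝕋_s[τ]` with `φ_θ = θ + A_1 τ + ⋯ + A_r τ^r`, `A_r ≠ 0`. -/
structure DrinfeldModule (r : ℕ) where
  toAlgHom : ATs F s →ₐ[MvPolynomial (Fin s) F] TwPoly (tau F s)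
  rank_pos : 1 ≤ r
  coeff_zero : (toAlgHom Polynomial.X).coeff 0 = theta F s
  coeff_rank_ne_zero : (toAlgHom Polynomial.X).coeff r ≠ 0
  coeff_eq_zero_of_gt : ∀ i, r < i → (toAlgHom Polynomial.X).coeff i = 0

/-- `𝕋_s[σ]`, where `σ = τ⁻¹`. -/
abbrev SigmaPoly : Type _ := TwPoly (tau F s)⁻¹

variable {F s}

/-- The map `* : 𝕋_s[τ] → 𝕋_s[σ]`, `(∑ f_i τ^i)^* = ∑ f_i^{(-i)} σ^i`. -/
def starMap (f : TwPoly (tau F s)) : SigmaPoly F s :=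
  ⟨TwSeries.mk fun i => twist (-(i : ℤ)) (f.coeff i), by
    obtain ⟨N, hN⟩ := f.2
    exact ⟨N, fun n hn => by
      rw [TwSeries.coeff_mk, TwPoly.coeff, hN n hn, map_zero]⟩⟩

/-- `δ_0 (∑ a_i σ^i) = a_0`. -/
def delta0 (m : SigmaPoly F s) : Tate F s := m.coeff 0

/-- `δ_1 (∑ a_i σ^i) = ∑ a_i^{(i)}`. -/
def delta1 (m : SigmaPoly F s) : Tate F s := ∑ᶠ i : ℕ, twist (i : ℤ) (m.coeff i)

namespace DrinfeldModule
variable {r : ℕ} (φ : DrinfeldModule F s r)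

/-- `φ_θ`. -/
def phiTheta : TwPoly (tau F s) := φ.toAlgHom Polynomial.X

/-- The coefficient `A_i` of `τ^i` in `φ_θ` (so `A_0 = θ`, and `A_i = 0` for `i > r`). -/
def A (i : ℕ) : Tate F s := φ.phiTheta.coeff i

/-! ### The exponential -/

/-- The coefficients `α_i` of the exponential series, given by `α_0 = 1` and
`(θ^{q^n} - θ) α_n = ∑_{i < n} A_{n-i} α_i^{(n-i)}`. -/
def expCoeff : ℕ → Tate F s
  | 0 => 1
  | n + 1 =>
    Tate.const (toCInf F (RatFunc.X ^ Fintype.card F ^ (n + 1) - RatFunc.X))⁻¹ *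
      ∑ i : Fin (n + 1), φ.A (n + 1 - i) * twist (n + 1 - i : ℤ) (expCoeff i)
  decreasing_by exact i.2

/-- The exponential series `exp_φ = ∑ α_i τ^i ∈ 𝕋_s[[τ]]`. -/
def expSeries : TwSeries (tau F s) := TwSeries.mk φ.expCoeff

theorem card_pow_ne (n : ℕ) :
    toCInf F (RatFunc.X ^ Fintype.card F ^ (n + 1) - RatFunc.X) ≠ 0 := by
  rw [map_ne_zero, sub_ne_zero, ← RatFunc.algebraMap_X, ← map_pow]
  intro h
  have h := RatFunc.algebraMap_injective F h
  have h := congrArg Polynomial.natDegree h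
  rw [Polynomial.natDegree_X_pow, Polynomial.natDegree_X] at h
  exact (Nat.one_lt_pow n.succ_ne_zero Fintype.one_lt_card).ne' h

theorem tau_pow_theta (n : ℕ) : (tau F s ^ n) (theta F s) =
    Tate.const (toCInf F (RatFunc.X ^ Fintype.card F ^ n)) := by
  induction n with
  | zero => simp [theta]
  | succ n ih =>
    rw [pow_succ', RingAut.mul_apply, ih, tau_const, ← map_pow, ← pow_mul, pow_succ]

/-- A series `E = ∑ e_i τ^i` with `e_0 = 1` satisfies `E θ = φ_θ E` iff it has the coefficients
above. -/
theorem mul_theta_iff (E : TwSeries (tau F s)) (h0 : E.coeff 0 = 1) :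
    E * (TwPoly.const (tau F s) (theta F s) : TwSeries (tau F s)) = φ.phiTheta.1 * E ↔
      E = φ.expSeries := by
  have key : ∀ n, ((E * (TwPoly.const (tau F s) (theta F s) : TwSeries (tau F s))).coeff (n + 1) =
      (φ.phiTheta.1 * E).coeff (n + 1)) ↔ E.coeff (n + 1) =
        Tate.const (toCInf F (RatFunc.X ^ Fintype.card F ^ (n + 1) - RatFunc.X))⁻¹ *
          ∑ i : Fin (n + 1), φ.A (n + 1 - i) * twist (n + 1 - i : ℤ) (E.coeff i) := by
    intro n
    have hs : (φ.phiTheta.1 * E).coeff (n + 1) = theta F s * E.coeff (n + 1) +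
        ∑ i : Fin (n + 1), φ.A (n + 1 - i) * twist (n + 1 - i : ℤ) (E.coeff i) := by
      rw [TwSeries.coeff_mul, Finset.Nat.sum_antidiagonal_succ]
      congr 1
      · change φ.phiTheta.coeff 0 * _ = _
        rw [phiTheta, φ.coeff_zero]
        simp
      · rw [← Finset.Nat.sum_antidiagonal_swap, Finset.Nat.sum_antidiagonal_eq_sum_range_succ_mk,
          Finset.sum_range]
        refine Finset.sum_congr rfl fun i _ => ?_
        have hi : (i : ℕ) ≤ n := Nat.lt_succ_iff.1 i.2
        have h1 : n + 1 - (i : ℕ) = n - i + 1 := by omega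
        have h2 : (n + 1 - i : ℤ) = ((n - i + 1 : ℕ) : ℤ) := by omega
        rw [h1, h2, twist, zpow_natCast]
        rfl
    rw [TwPoly.coeff_mul_const, tau_pow_theta, hs]
    set S := ∑ i : Fin (n + 1), φ.A (n + 1 - i) * twist (n + 1 - i : ℤ) (E.coeff i)
    set c := toCInf F (RatFunc.X ^ Fintype.card F ^ (n + 1) - RatFunc.X) with hc
    have hc0 : c ≠ 0 := card_pow_ne n
    have h1 : Tate.const (toCInf F (RatFunc.X ^ Fintype.card F ^ (n + 1))) =
        Tate.const c + theta F s := by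
      rw [hc, theta, ← map_add, ← map_add, sub_add_cancel]
    have h2 : (Tate.const c : Tate F s) * Tate.const c⁻¹ = 1 := by
      rw [← map_mul, mul_inv_cancel₀ hc0, map_one]
    rw [h1]
    constructor
    · intro h
      linear_combination (Tate.const c⁻¹) * h - E.coeff (n + 1) * h2
    · intro h
      linear_combination (Tate.const c) * h + S * h2
  constructor
  · intro h
    ext n
    induction n using Nat.strong_induction_on with
    | _ n ih =>
      cases n with
      | zero => rw [h0, expSeries, TwSeries.coeff_mk, expCoeff]
      | succ n =>
        rw [(key n).1 (by rw [h]), expSeries, TwSeries.coeff_mk, expCoeff]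
        congr 1
        refine Finset.sum_congr rfl fun i _ => ?_
        rw [ih i i.2]
        rfl
  · rintro rfl
    ext n
    cases n with
    | zero =>
      rw [TwPoly.coeff_mul_const, TwSeries.coeff_mul]
      simp only [Finset.HasAntidiagonal.antidiagonal_zero, Finset.sum_singleton, pow_zero]
      change _ = φ.phiTheta.coeff 0 * _
      rw [phiTheta, φ.coeff_zero]
      exact mul_comm _ _
    | succ n =>
      rw [key n]
      conv_lhs => rw [expSeries, TwSeries.coeff_mk, expCoeff]
      rfl

/-- `exp_φ` is the unique series with `α_0 = 1` and `exp_φ a = φ_a exp_φ` for all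
`a ∈ A[t_1, …, t_s]`. -/
theorem expSeries_unique (E : TwSeries (tau F s)) :
    (E.coeff 0 = 1 ∧ ∀ a : ATs F s,
      E * (TwPoly.const (tau F s) (atsToTate F s a) : TwSeries (tau F s)) =
        (φ.toAlgHom a).1 * E) ↔ E = φ.expSeries := by
  constructor
  · rintro ⟨h0, h⟩
    rw [← φ.mul_theta_iff E h0]
    simpa [atsToTate, phiTheta] using h Polynomial.X
  · rintro rfl
    have h0 : φ.expSeries.coeff 0 = 1 := by
      rw [expSeries, TwSeries.coeff_mk, expCoeff]
    refine ⟨h0, fun a => ?_⟩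
    have hX := (φ.mul_theta_iff _ h0).2 rfl
    induction a using Polynomial.induction_on' with
    | add p q hp hq =>
      rw [map_add, map_add, map_add, Subring.coe_add, Subring.coe_add, mul_add, add_mul, hp, hq]
    | monomial n c =>
      induction n with
      | zero =>
        rw [Polynomial.monomial_zero_left]
        have h1 : atsToTate F s (Polynomial.C c) = polyToTate F s c := by simp [atsToTate]
        have h2 : φ.toAlgHom (Polynomial.C c) = TwPoly.const (tau F s) (polyToTate F s c) :=
          φ.toAlgHom.commutes c
        rw [h1, h2]
        ext n
        rw [TwPoly.coeff_const_mul, TwPoly.coeff_mul_const, tau_pow_polyToTate, mul_comm]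
      | succ n ih =>
        rw [← Polynomial.monomial_mul_X, map_mul, map_mul, map_mul, Subring.coe_mul,
          Subring.coe_mul, ← mul_assoc, ih, mul_assoc, mul_assoc]
        congr 1
        simpa [atsToTate, phiTheta] using hX

/-- The exponential function `exp_φ : 𝕋_s → 𝕋_s`, `exp_φ(f) = ∑ α_i f^{(i)}`, the sum being taken
with respect to the Gauss norm. -/
def exp (f : Tate F s) : Tate F s := ∑' i : ℕ, φ.expCoeff i * twist (i : ℤ) f

/-! ### The Frobenius module and the standard `z`-frame -/

/-- The action of `𝕋_s[z]` on `H(φ) = 𝕋_s[σ]`: `𝕋_s` acts by left multiplication and `z` acts by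
right multiplication by `φ_θ^*`. -/
def zAct (p : (Tate F s)[X]) (m : SigmaPoly F s) : SigmaPoly F s :=
  Polynomial.aeval (TwPoly.rightMul (starMap φ.phiTheta)) p m

/-- `ι(h) = h_1 · 1 + h_2 · σ + ⋯ + h_r · σ^{r-1}`. -/
def iota (h : Fin r → (Tate F s)[X]) : SigmaPoly F s :=
  ∑ i : Fin r, φ.zAct (h i) (TwPoly.gen _ ^ (i : ℕ))

/-- The matrix `Φ`: ones above the diagonal, last row
`((z - θ)/A_r^{(-r)}, -A_1^{(-1)}/A_r^{(-r)}, …, -A_{r-1}^{(-r+1)}/A_r^{(-r)})`, and zeros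
elsewhere. It is meaningful when `A_r` is a unit. -/
def Phi : Matrix (Fin r) (Fin r) (Tate F s)[X] := Matrix.of fun i j =>
  if (i : ℕ) + 1 = r then
    Polynomial.C (Ring.inverse (twist (-(r : ℤ)) (φ.A r))) *
      if (j : ℕ) = 0 then Polynomial.X - Polynomial.C (theta F s)
      else -Polynomial.C (twist (-(j : ℤ)) (φ.A j))
  else if (j : ℕ) = i + 1 then 1 else 0

/-- `σ p = Φ p` for the basis `p = (1, σ, …, σ^{r-1})` of `H(φ)`. -/
theorem Phi_spec (hA : IsUnit (φ.A r)) (i : Fin r) :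
    TwPoly.gen _ * TwPoly.gen _ ^ (i : ℕ) =
      ∑ j : Fin r, φ.zAct (φ.Phi i j) (TwPoly.gen _ ^ (j : ℕ)) := by
  rw [← pow_succ']
  by_cases hi : (i : ℕ) + 1 = r
  · obtain ⟨u, hu⟩ := hA.map (twist (-(r : ℤ)) : Tate F s ≃+* Tate F s)
    have hz : ∀ j : Fin r, φ.zAct (φ.Phi i j) (TwPoly.gen _ ^ (j : ℕ)) =
        (↑u⁻¹ : Tate F s) • ((if (j : ℕ) = 0 then starMap φ.phiTheta else 0) -
          twist (-(j : ℤ)) (φ.A j) • (TwPoly.gen _ ^ (j : ℕ) : SigmaPoly F s)) := by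
      intro j
      have hinv : Ring.inverse (twist (-(r : ℤ)) (φ.A r)) = (↑u⁻¹ : Tate F s) := by
        rw [← Ring.inverse_unit u, hu]
      simp only [Phi, Matrix.of_apply, hi, if_true, hinv]
      by_cases hj : (j : ℕ) = 0
      · have hA0 : φ.A 0 = theta F s := φ.coeff_zero
        simp only [hj, if_true, zAct, map_mul, map_sub, Polynomial.aeval_C, Polynomial.aeval_X,
          Module.End.mul_apply, Module.algebraMap_end_apply, LinearMap.sub_apply, hA0, pow_zero,
          Nat.cast_zero, neg_zero, twist, zpow_zero, RingAut.one_apply]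
        rw [TwPoly.rightMul, ← smul_sub]
        simp [smul_sub]
      · simp only [hj, if_false, zAct, map_mul, map_neg, Polynomial.aeval_C,
          Module.End.mul_apply, Module.algebraMap_end_apply, LinearMap.neg_apply, zero_sub,
          smul_neg]
    rw [Finset.sum_congr rfl fun j _ => hz j, ← Finset.smul_sum, Finset.sum_sub_distrib]
    have h1 : ∑ j : Fin r, (if (j : ℕ) = 0 then starMap φ.phiTheta else 0) = starMap φ.phiTheta := by
      rw [Finset.sum_eq_single ⟨0, φ.rank_pos⟩] <;> simp +contextual [Fin.ext_iff]
    have h2 : starMap φ.phiTheta = ∑ j : Fin r,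
        twist (-(j : ℤ)) (φ.A j) • (TwPoly.gen _ ^ (j : ℕ) : SigmaPoly F s) +
          (u : Tate F s) • TwPoly.gen _ ^ r := by
      rw [hu]
      rw [Fin.sum_univ_eq_sum_range (fun j : ℕ => twist (-(j : ℤ)) (φ.A j) •
        (TwPoly.gen _ ^ (j : ℕ) : SigmaPoly F s)), ← Finset.sum_range_succ]
      refine TwPoly.ext fun n => ?_
      rw [TwPoly.coeff_sum]
      simp only [TwPoly.coeff_smul, TwPoly.coeff_gen_pow]
      have h3 : (starMap φ.phiTheta).coeff n = twist (-(n : ℤ)) (φ.A n) := rfl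
      rw [h3]
      by_cases hn : n ∈ Finset.range (r + 1)
      · simp [hn]
      · rw [Finset.mem_range, not_lt] at hn
        have h4 : φ.A n = 0 := φ.coeff_eq_zero_of_gt n hn
        rw [h4, map_zero, Finset.sum_eq_zero]
        intro j hj
        rw [if_neg, mul_zero]
        rintro rfl
        simp at hj
        omega
    rw [h1, h2, add_sub_cancel_left, smul_smul, Units.inv_mul, one_smul, hi]
  · have hlt : (i : ℕ) + 1 < r := lt_of_le_of_ne i.2 hi
    rw [Finset.sum_eq_single ⟨i + 1, hlt⟩]
    · simp [Phi, hi, zAct]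
    · intro j _ hj
      have : (j : ℕ) ≠ i + 1 := fun h => hj (Fin.ext h)
      simp [Phi, hi, zAct, this]
    · simp

end DrinfeldModule

/-! ### The ring `𝕋_s{z/θ}` and the map `D_0` -/

variable (F s) in
/-- `𝕋_s{z/θ}`: power series `∑ a_i z^i` over `𝕋_s` with `‖θ‖^i ‖a_i‖ → 0`. -/
def tateDisk : AddSubgroup (PowerSeries (Tate F s)) where
  carrier := {f | Tendsto (fun i => ‖theta F s‖ ^ i * ‖PowerSeries.coeff i f‖) atTop (𝓝 0)}
  zero_mem' := by simp
  add_mem' := by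
    intro f g hf hg
    refine squeeze_zero (fun i => by positivity) (fun i => ?_) (by simpa using hf.add hg)
    rw [← mul_add, map_add]
    gcongr
    exact norm_add_le _ _
  neg_mem' := by
    intro f hf
    simpa using hf

theorem theta_norm_pos : 0 < ‖theta F s‖ := by
  rw [norm_pos_iff, theta]
  intro h
  have h := congrArg (Tate.coeff 0) h
  rw [map_zero] at h
  rw [Tate.coeff_zero_const] at h
  exact RatFunc.X_ne_zero ((map_eq_zero _).1 h)

theorem tateDisk_bddAbove (f : tateDisk F s) :
    BddAbove (Set.range fun i => ‖theta F s‖ ^ i * ‖PowerSeries.coeff i f.1‖) :=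
  f.2.bddAbove_range

/-- The norm `‖∑ a_i z^i‖_θ = sup_i ‖θ‖^i ‖a_i‖` on `𝕋_s{z/θ}`. -/
instance : NormedAddCommGroup (tateDisk F s) :=
  AddGroupNorm.toNormedAddCommGroup
    { toFun := fun f => ⨆ i, ‖theta F s‖ ^ i * ‖PowerSeries.coeff i f.1‖
      map_zero' := by simp
      add_le' := fun f g => ciSup_le fun i => by
        refine le_trans ?_ (add_le_add (le_ciSup (tateDisk_bddAbove f) i)
          (le_ciSup (tateDisk_bddAbove g) i))
        rw [← mul_add]
        gcongr
        exact norm_add_le _ _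
      neg' := fun f => by simp
      eq_zero_of_map_eq_zero' := fun f hf => Subtype.ext <| PowerSeries.ext fun i => by
        have h := (le_ciSup (tateDisk_bddAbove f) i).trans hf.le
        have h' := nonpos_of_mul_nonpos_right h (pow_pos theta_norm_pos i)
        simpa using h' }

/-- The inclusion `𝕋_s[z] → 𝕋_s{z/θ}`. -/
def polyToDisk (p : (Tate F s)[X]) : tateDisk F s :=
  ⟨(p : PowerSeries (Tate F s)), by
    refine tendsto_nhds_of_eventually_eq ?_
    filter_upwards [eventually_gt_atTop p.natDegree] with i hi
    rw [Polynomial.coeff_coe, Polynomial.coeff_eq_zero_of_natDegree_lt hi, norm_zero, mul_zero]⟩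

/-- The inclusion of row vectors `Mat_{1×r}(𝕋_s[z]) → Mat_{1×r}(𝕋_s{z/θ})`, where the target
carries the maximum of the norms `‖·‖_θ` of the entries. -/
def vecToDisk {r : ℕ} (h : Fin r → (Tate F s)[X]) : Fin r → tateDisk F s :=
  fun i => polyToDisk (h i)

theorem denseRange_vecToDisk {r : ℕ} :
    DenseRange (vecToDisk : (Fin r → (Tate F s)[X]) → Fin r → tateDisk F s) := by
  have h1 : DenseRange (polyToDisk : (Tate F s)[X] → tateDisk F s) := by
    intro f
    refine Metric.mem_closure_range_iff.2 fun ε hε => ?_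
    obtain ⟨N, hN⟩ := eventually_atTop.1 (f.2.eventually (gt_mem_nhds (half_pos hε)))
    refine ⟨PowerSeries.trunc N f.1, lt_of_le_of_lt ?_ (half_lt_self hε)⟩
    rw [dist_eq_norm]
    refine ciSup_le fun i => ?_
    change _ * ‖PowerSeries.coeff i (f.1 - (PowerSeries.trunc N f.1 : PowerSeries (Tate F s)))‖ ≤ _
    rw [map_sub, Polynomial.coeff_coe, PowerSeries.coeff_trunc]
    split_ifs with h
    · rw [sub_self, norm_zero, mul_zero]
      exact (half_pos hε).le
    · rw [sub_zero]
      exact (hN i (not_lt.1 h)).le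
  exact DenseRange.piMap fun _ => h1

namespace DrinfeldModule
variable {r : ℕ} (φ : DrinfeldModule F s r)

/-- `D_0`, the extension of `δ_0 ∘ ι` by continuity from `Mat_{1×r}(𝕋_s[z])` to
`Mat_{1×r}(𝕋_s{z/θ})`: the limit of `δ_0(ι(h))` as the polynomial vector `h` tends to `g`. -/
def D0 (g : Fin r → tateDisk F s) : Tate F s :=
  limUnder (comap vecToDisk (𝓝 g)) fun h => delta0 (φ.iota h)

end DrinfeldModule
end Drinfeld
end DrinfeldTate

end

open DrinfeldTate

/-!
Dividing the equation `g^{(-1)} Φ - g = h` by `z ^ n` and moving the terms in the first `n`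
coefficients of `g` to the right leaves an equation of the same shape, with right-hand side a
polynomial vector `h_n`. Put `d_n = δ_1(ι(h_n))`. As `ι` turns multiplication by `z` into right
multiplication by `φ_θ^*` and `P ↦ P^{(-1)} Φ` into left multiplication by `σ`, which `δ_1` does not
see, `φ_θ(d_{n+1}) = d_n`. For large `n` the vector `h_n` is constant and concentrated in its first
entry, so that evaluating that entry at `z = θ` gives `θ^n d_n → ξ = D_0(g + h)`.

The sequence `exp_φ(θ^{-n} ξ)` has both properties too, as `exp_φ(f) = f + o(f)`. The difference
`e_n` of the two sequences satisfies `φ_θ(e_{n+1}) = e_n` and `θ^n e_n → 0`. But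
`‖φ_θ(f)‖ ≤ ‖θ‖ ‖f‖` for small `f`, so `‖θ^n e_n‖` is eventually nondecreasing, which forces
`e_n = 0` for large `n`, hence for all `n`. At `n = 0` this reads `exp_φ(ξ) = d_0 = δ_1(ι(h))`.
-/

noncomputable section

namespace DrinfeldTate

variable {F : Type*} [Field F] [Fintype F] {s r : ℕ}

/-! ### The Gauss norm -/

namespace Tate

theorem norm_coeff_le (f : Tate F s) (ν : Fin s →₀ ℕ) : ‖f.coeff ν‖ ≤ ‖f‖ :=
  le_ciSup f.bddAbove ν

theorem norm_le {f : Tate F s} {C : ℝ} (h : ∀ ν, ‖f.coeff ν‖ ≤ C) : ‖f‖ ≤ C :=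
  ciSup_le h

instance : IsUltrametricDist (Tate F s) :=
  IsUltrametricDist.isUltrametricDist_of_forall_norm_add_le_max_norm fun f g =>
    norm_le fun ν => by
      rw [map_add]
      exact (IsUltrametricDist.norm_add_le_max _ _).trans
        (max_le_max (norm_coeff_le f ν) (norm_coeff_le g ν))

theorem coeff_mul [DecidableEq (Fin s)] (f g : Tate F s) (ν : Fin s →₀ ℕ) :
    (f * g).coeff ν = ∑ p ∈ Finset.HasAntidiagonal.antidiagonal ν, f.coeff p.1 * g.coeff p.2 :=
  MvPowerSeries.coeff_mul ν f.1 g.1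

/-- The Gauss norm makes `𝕋_s` a normed ring. -/
abbrev normedCommRing : NormedCommRing (Tate F s) :=
  { (inferInstance : NormedAddCommGroup (Tate F s)), (inferInstance : CommRing (Tate F s)) with
    norm_mul_le f g := by
      classical
      refine norm_le fun ν => ?_
      rw [coeff_mul]
      refine IsUltrametricDist.norm_sum_le_of_forall_le_of_nonneg (by positivity) fun p _ => ?_
      rw [norm_mul]
      gcongr <;> apply norm_coeff_le }

attribute [local instance] normedCommRing

theorem coeff_const_mul (a : CInf F) (f : Tate F s) (ν : Fin s →₀ ℕ) :
    (const a * f).coeff ν = a * f.coeff ν :=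
  MvPowerSeries.coeff_C_mul ν f.1 a

theorem norm_const_mul (a : CInf F) (f : Tate F s) : ‖const a * f‖ = ‖a‖ * ‖f‖ := by
  simp_rw [norm_def, coeff_const_mul, norm_mul]
  exact (Real.mul_iSup_of_nonneg (norm_nonneg a) _).symm

theorem norm_const (a : CInf F) : ‖(const a : Tate F s)‖ = ‖a‖ := by
  classical
  refine le_antisymm (norm_le fun ν => ?_) ?_
  · change ‖MvPowerSeries.coeff ν (MvPowerSeries.C a)‖ ≤ _
    rw [MvPowerSeries.coeff_C]
    split_ifs <;> simp
  · simpa only [coeff_zero_const] using norm_coeff_le (const a : Tate F s) 0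

instance : NormOneClass (Tate F s) where
  norm_one := by rw [← map_one const, norm_const, norm_one]

/- Passing to coefficients identifies `𝕋_s` isometrically with the `ℂ_∞`-valued functions on the
discrete space of exponents that vanish at infinity. -/
instance : CompleteSpace (Tate F s) := by
  let _ : TopologicalSpace (Fin s →₀ ℕ) := ⊥
  have : DiscreteTopology (Fin s →₀ ℕ) := ⟨rfl⟩
  let coeffs : Tate F s →+ ZeroAtInftyContinuousMap (Fin s →₀ ℕ) (CInf F) :=
    { toFun f := ⟨⟨fun ν => f.coeff ν, continuous_of_discreteTopology⟩, by
        rw [cocompact_eq_cofinite]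
        exact tendsto_zero_iff_norm_tendsto_zero.2 f.tendsto_coeff⟩
      map_zero' := by ext; simp
      map_add' f g := by ext; simp }
  have isometry : Isometry coeffs := (AddMonoidHomClass.isometry_iff_norm coeffs).2 fun f => by
    rw [← ZeroAtInftyContinuousMap.norm_toBCF_eq_norm, BoundedContinuousFunction.norm_eq_iSup_norm]
    rfl
  have surjective : Function.Surjective coeffs := fun u =>
    ⟨⟨fun ν => u ν, isRestricted_one_iff.2 <| tendsto_zero_iff_norm_tendsto_zero.1 <| by
      have := u.zero_at_infty'
      rwa [cocompact_eq_cofinite] at this⟩, by ext; rfl⟩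
  exact (isometry.isUniformInducing.completeSpace_congr surjective).2 inferInstance

end Tate

attribute [local instance] Tate.normedCommRing

theorem norm_theta : ‖theta F s‖ = Fintype.card F := by
  rw [theta, Tate.norm_const, norm_toCInf, inftyAbs_X]

theorem norm_theta_pow_mul (n : ℕ) (f : Tate F s) :
    ‖theta F s ^ n * f‖ = (Fintype.card F : ℝ) ^ n * ‖f‖ := by
  rw [theta, ← map_pow, Tate.norm_const_mul, norm_pow, norm_toCInf, inftyAbs_X]

theorem isUnit_theta : IsUnit (theta F s) :=
  ((isUnit_iff_ne_zero.2 RatFunc.X_ne_zero).map (toCInf F)).map Tate.const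

theorem norm_tau (f : Tate F s) : ‖tau F s f‖ = ‖f‖ ^ Fintype.card F := by
  simp_rw [Tate.norm_def, Real.iSup_pow fun ν => norm_nonneg (f.coeff ν), tau_coeff, norm_pow]

theorem twist_natCast (n : ℕ) : twist (F := F) (s := s) (n : ℤ) = tau F s ^ n :=
  zpow_natCast _ _

theorem norm_twist (n : ℕ) (f : Tate F s) :
    ‖twist (n : ℤ) f‖ = ‖f‖ ^ Fintype.card F ^ n := by
  rw [twist_natCast]
  induction n with
  | zero => simp
  | succ n ih => rw [pow_succ', RingAut.mul_apply, norm_tau, ih, ← pow_mul, pow_succ]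

theorem twist_add (m n : ℤ) (f : Tate F s) : twist (m + n) f = twist m (twist n f) := by
  rw [twist, zpow_add, RingAut.mul_apply]; rfl

theorem twist_zero (f : Tate F s) : twist 0 f = f := by simp [twist]

theorem continuous_twist (n : ℕ) : Continuous (twist (n : ℤ) : Tate F s → Tate F s) := by
  refine continuous_of_continuousAt_zero (twist (n : ℤ) : Tate F s ≃+* Tate F s) ?_
  rw [ContinuousAt, map_zero, tendsto_zero_iff_norm_tendsto_zero]
  simp_rw [norm_twist]
  exact (continuous_norm.pow _).tendsto' _ _ (by simp)

/-! ### Twisted polynomials -/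

namespace TwPoly

variable {R : Type*} [CommRing R] {σ : RingAut R}

theorem coeff_add (m n : TwPoly σ) (i : ℕ) : (m + n).coeff i = m.coeff i + n.coeff i := rfl

theorem coeff_zero_mul (m n : TwPoly σ) : (m * n).coeff 0 = m.coeff 0 * n.coeff 0 := by
  change (m.1 * n.1).coeff 0 = _
  rw [TwSeries.coeff_mul, Finset.HasAntidiagonal.antidiagonal_zero, Finset.sum_singleton, pow_zero]
  rfl

theorem gen_pow_mul_smul (i : ℕ) (a : R) (m : TwPoly σ) :
    gen σ ^ i * (a • m) = (σ ^ i) a • (gen σ ^ i * m) := by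
  suffices gen σ ^ i * const σ a = const σ ((σ ^ i) a) * gen σ ^ i by
    rw [smul_def, smul_def, ← mul_assoc, this, mul_assoc]
  refine ext fun n => ?_
  calc (gen σ ^ i * const σ a).coeff n = (gen σ ^ i).coeff n * (σ ^ n) a :=
        coeff_mul_const a (gen σ ^ i).1 n
    _ = (σ ^ i) a * (gen σ ^ i).coeff n := by
        rw [coeff_gen_pow]
        split_ifs with h
        · rw [h, mul_comm]
        · simp
    _ = _ := (coeff_const_mul _ (gen σ ^ i).1 n).symm

theorem gen_mul_smul (a : R) (m : TwPoly σ) : gen σ * (a • m) = σ a • (gen σ * m) := by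
  simpa only [pow_one] using gen_pow_mul_smul 1 a m

theorem smul_gen_pow_mul_smul_gen_pow (a b : R) (i k : ℕ) :
    (a • gen σ ^ i) * (b • gen σ ^ k) = (a * (σ ^ i) b) • gen σ ^ (i + k) := by
  rw [smul_def a, mul_assoc, gen_pow_mul_smul, ← smul_def, smul_smul, pow_add]

theorem coeff_gen_pow_mul (E : TwSeries σ) (k n : ℕ) :
    ((gen σ ^ k : TwPoly σ) * E : TwSeries σ).coeff n =
      if k ≤ n then (σ ^ k) (E.coeff (n - k)) else 0 := by
  have coeff_gen (i : ℕ) : (gen σ ^ k).1.coeff i = if i = k then 1 else 0 :=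
    coeff_gen_pow k i
  rw [TwSeries.coeff_mul, Finset.Nat.sum_antidiagonal_eq_sum_range_succ_mk]
  simp_rw [coeff_gen, ite_mul, one_mul, zero_mul, Finset.sum_ite_eq', Finset.mem_range,
    Nat.lt_succ_iff]

theorem finite_support_coeff (m : TwPoly σ) : m.coeff.support.Finite := by
  obtain ⟨N, hN⟩ := m.2
  exact (Set.finite_lt_nat N).subset fun n hn => not_le.1 fun h => hn (hN n h)

theorem eq_sum (m : TwPoly σ) :
    m = ∑ i ∈ m.finite_support_coeff.toFinset, m.coeff i • gen σ ^ i := by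
  refine ext fun n => ?_
  simp [coeff_sum, coeff_smul, coeff_gen_pow, eq_comm]

@[elab_as_elim]
theorem induction_on {p : TwPoly σ → Prop} (m : TwPoly σ)
    (smul_gen_pow : ∀ (c : R) (n : ℕ), p (c • gen σ ^ n))
    (add : ∀ m n, p m → p n → p (m + n)) : p m := by
  rw [eq_sum m]
  exact Finset.sum_induction _ p add (by simpa using smul_gen_pow 0 0) fun i _ => smul_gen_pow _ i

/-- The additive map `∑ a_j σ^j ↦ ∑ u_j(a_j)` on twisted polynomials. -/
def liftAddHom {M : Type*} [AddCommMonoid M] (u : ℕ → R →+ M) : TwPoly σ →+ M where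
  toFun m := ∑ᶠ j, u j (m.coeff j)
  map_zero' := finsum_eq_zero_of_forall_eq_zero fun j => map_zero (u j)
  map_add' m n := by
    have finite (m : TwPoly σ) : (fun j => u j (m.coeff j)).support.Finite :=
      m.finite_support_coeff.subset fun j hj h => hj (by simp [h])
    simp_rw [coeff_add, map_add]
    exact finsum_add_distrib (finite m) (finite n)

theorem liftAddHom_smul_gen_pow {M : Type*} [AddCommMonoid M] (u : ℕ → R →+ M) (c : R) (n : ℕ) :
    liftAddHom u (c • gen σ ^ n) = u n c := by
  have off (j : ℕ) (hj : j ≠ n) : u j ((c • gen σ ^ n).coeff j) = 0 := by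
    rw [coeff_smul, coeff_gen_pow, if_neg hj, mul_zero, map_zero]
  refine (finsum_eq_single _ n off).trans ?_
  rw [coeff_smul, coeff_gen_pow, if_pos rfl, mul_one]

end TwPoly

/-- The action of `𝕋_s[τ]` on `𝕋_s`, `(∑ a_j τ^j)(f) = ∑ a_j f^{(j)}`. -/
def tauEval : TwPoly (tau F s) →+ Tate F s →+ Tate F s :=
  TwPoly.liftAddHom fun j => AddMonoidHom.mul.compl₂ (twist (j : ℤ)).toAddMonoidHom

theorem tauEval_smul_gen_pow (c : Tate F s) (n : ℕ) (f : Tate F s) :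
    tauEval (c • TwPoly.gen _ ^ n) f = c * twist (n : ℤ) f := by
  rw [tauEval, TwPoly.liftAddHom_smul_gen_pow]
  rfl

/-- `δ_1` as an additive homomorphism. -/
def delta1Hom : SigmaPoly F s →+ Tate F s :=
  TwPoly.liftAddHom fun j => (twist (j : ℤ)).toAddMonoidHom

theorem delta1_add (m n : SigmaPoly F s) : delta1 (m + n) = delta1 m + delta1 n :=
  map_add delta1Hom m n

theorem delta1_smul_gen_pow (c : Tate F s) (n : ℕ) :
    delta1 (c • TwPoly.gen _ ^ n : SigmaPoly F s) = twist (n : ℤ) c :=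
  TwPoly.liftAddHom_smul_gen_pow (fun j => (twist (j : ℤ)).toAddMonoidHom) c n

theorem inv_tau_pow_apply (n : ℕ) (f : Tate F s) : ((tau F s)⁻¹ ^ n) f = twist (-(n : ℤ)) f := by
  rw [twist, zpow_neg, zpow_natCast, inv_pow]

theorem starMap_add (P Q : TwPoly (tau F s)) : starMap (P + Q) = starMap P + starMap Q :=
  TwPoly.ext fun i => map_add (twist (-(i : ℤ))) (P.coeff i) (Q.coeff i)

theorem starMap_smul_gen_pow (c : Tate F s) (n : ℕ) :
    starMap (c • TwPoly.gen _ ^ n) = twist (-(n : ℤ)) c • TwPoly.gen (tau F s)⁻¹ ^ n := by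
  refine TwPoly.ext fun i => ?_
  change twist (-(i : ℤ)) _ = _
  rw [TwPoly.coeff_smul, TwPoly.coeff_gen_pow, TwPoly.coeff_smul, TwPoly.coeff_gen_pow]
  split_ifs with h <;> simp [h]

theorem delta1_gen_mul (m : SigmaPoly F s) : delta1 (TwPoly.gen _ * m) = delta1 m := by
  induction m using TwPoly.induction_on with
  | add m n hm hn => rw [mul_add, delta1_add, delta1_add, hm, hn]
  | smul_gen_pow c n =>
    rw [TwPoly.gen_mul_smul, ← pow_succ', delta1_smul_gen_pow, delta1_smul_gen_pow,
      ← pow_one (tau F s)⁻¹, inv_tau_pow_apply, ← twist_add]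
    congr 2
    push_cast
    ring

theorem delta1_mul_starMap (m : SigmaPoly F s) (P : TwPoly (tau F s)) :
    delta1 (m * starMap P) = tauEval P (delta1 m) := by
  induction m using TwPoly.induction_on with
  | add m n hm hn => rw [add_mul, delta1_add, delta1_add, hm, hn, map_add]
  | smul_gen_pow c k =>
    induction P using TwPoly.induction_on with
    | add P Q hP hQ =>
      rw [starMap_add, mul_add, delta1_add, hP, hQ, map_add, AddMonoidHom.add_apply]
    | smul_gen_pow d n =>
      rw [starMap_smul_gen_pow, TwPoly.smul_gen_pow_mul_smul_gen_pow, delta1_smul_gen_pow,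
        delta1_smul_gen_pow, tauEval_smul_gen_pow, inv_tau_pow_apply, map_mul]
      have twist_c : twist ((k + n : ℕ) : ℤ) c = twist (n : ℤ) (twist (k : ℤ) c) := by
        rw [Nat.cast_add, add_comm, twist_add]
      have twist_d : twist ((k + n : ℕ) : ℤ) (twist (-(k : ℤ)) (twist (-(n : ℤ)) d)) = d := by
        rw [← twist_add, ← twist_add, Nat.cast_add, add_neg_cancel_comm, add_neg_cancel, twist_zero]
      rw [twist_c, twist_d, mul_comm]

theorem tauEval_sub_coeff_zero_mul_isLittleO (P : TwPoly (tau F s)) :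
    (fun f => tauEval P f - P.coeff 0 * f) =o[𝓝 0] fun f => f := by
  induction P using TwPoly.induction_on with
  | add P Q hP hQ =>
    refine (hP.add hQ).congr_left fun f => ?_
    rw [TwPoly.coeff_add, map_add, AddMonoidHom.add_apply]
    ring
  | smul_gen_pow c n =>
    rcases n.eq_zero_or_pos with rfl | hn
    · refine (Asymptotics.isLittleO_zero _ _).congr_left fun f => ?_
      rw [tauEval_smul_gen_pow, TwPoly.coeff_smul, TwPoly.coeff_gen_pow]
      simp [twist_zero]
    · have hq : 1 < Fintype.card F ^ n := Nat.one_lt_pow hn.ne' Fintype.one_lt_card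
      refine Asymptotics.IsLittleO.of_norm_left ?_
      refine Asymptotics.IsBigO.trans_isLittleO ?_ (Asymptotics.isLittleO_norm_pow_id hq)
      refine Asymptotics.IsBigO.of_bound ‖c‖ (.of_forall fun f => ?_)
      rw [tauEval_smul_gen_pow, TwPoly.coeff_smul, TwPoly.coeff_gen_pow, if_neg hn.ne, mul_zero,
        zero_mul, sub_zero, norm_norm, norm_pow, norm_norm, ← norm_twist]
      exact norm_mul_le _ _

theorem hasSum_coeff_mul_twist_tauEval (P : TwPoly (tau F s)) {E : TwSeries (tau F s)}
    {f y : Tate F s} (hE : HasSum (fun n : ℕ => E.coeff n * twist (n : ℤ) f) y) :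
    HasSum (fun n : ℕ => (P.1 * E).coeff n * twist (n : ℤ) f) (tauEval P y) := by
  induction P using TwPoly.induction_on with
  | add P Q hP hQ =>
    convert hP.add hQ using 2 with n
    · change ((P.1 + Q.1) * E).coeff n * _ = _
      rw [add_mul, map_add, add_mul]
    · rw [map_add, AddMonoidHom.add_apply]
  | smul_gen_pow c k =>
    have coeff_eq (n : ℕ) : ((c • TwPoly.gen (tau F s) ^ k).1 * E).coeff n =
        c * if k ≤ n then twist (k : ℤ) (E.coeff (n - k)) else 0 := by
      rw [twist_natCast, ← TwPoly.coeff_gen_pow_mul, ← TwPoly.coeff_const_mul, ← mul_assoc]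
      rfl
    have shifted : HasSum (fun n : ℕ => c * twist (k : ℤ) (E.coeff n * twist (n : ℤ) f))
        (c * twist (k : ℤ) y) :=
      (hE.map (twist (k : ℤ) : Tate F s ≃+* Tate F s) (continuous_twist k)).mul_left c
    rw [tauEval_smul_gen_pow, ← (add_left_injective k).hasSum_iff]
    · refine shifted.congr_fun fun n => ?_
      rw [Function.comp_apply, coeff_eq, if_pos (Nat.le_add_left k n), Nat.add_sub_cancel, map_mul,
        ← twist_add, mul_assoc, Nat.cast_add, add_comm (n : ℤ)]
    · intro n hn
      have : ¬ k ≤ n := fun h => hn ⟨n - k, Nat.sub_add_cancel h⟩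
      rw [coeff_eq, if_neg this, mul_zero, zero_mul]

/-! ### The exponential function -/

theorem eq_zero_of_tower {E : Type*} [NormedAddCommGroup E] {L : E →+ E} {c : ℝ} (hc : 1 ≤ c)
    (hL : ∀ᶠ x in 𝓝 0, ‖L x‖ ≤ c * ‖x‖) {e : ℕ → E} (he : ∀ n, L (e (n + 1)) = e n)
    (hlim : Tendsto (fun n => c ^ n * ‖e n‖) atTop (𝓝 0)) : e 0 = 0 := by
  have tendsto_e : Tendsto e atTop (𝓝 0) := squeeze_zero_norm
    (fun n => le_mul_of_one_le_left (norm_nonneg _) (one_le_pow₀ hc)) hlim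
  obtain ⟨N, hN⟩ := eventually_atTop.1 (tendsto_e.eventually hL)
  have monotone : Monotone fun k => c ^ (k + N) * ‖e (k + N)‖ := monotone_nat_of_le_succ fun k => by
    have := hN (k + N + 1) (by omega)
    rw [he] at this
    calc c ^ (k + N) * ‖e (k + N)‖ ≤ c ^ (k + N) * (c * ‖e (k + N + 1)‖) := by gcongr
      _ = c ^ (k + 1 + N) * ‖e (k + 1 + N)‖ := by
        rw [add_right_comm k 1, pow_succ, mul_assoc]
  have e_N : e N = 0 := by
    have := monotone.ge_of_tendsto ((tendsto_add_atTop_iff_nat N).2 hlim) 0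
    rw [zero_add] at this
    exact norm_le_zero_iff.1 (nonpos_of_mul_nonpos_right this (by positivity))
  clear hN monotone
  induction N with
  | zero => exact e_N
  | succ N ih => exact ih (by rw [← he, e_N, map_zero])

theorem norm_toCInf_X_pow_card_pow_sub_X (n : ℕ) :
    ‖toCInf F (RatFunc.X ^ Fintype.card F ^ (n + 1) - RatFunc.X)‖ =
      (Fintype.card F : ℝ) ^ Fintype.card F ^ (n + 1) := by
  have hq : (1 : ℝ) < Fintype.card F := by exact_mod_cast Fintype.one_lt_card
  have norm_lt : ‖toCInf F RatFunc.X‖ < ‖toCInf F (RatFunc.X ^ Fintype.card F ^ (n + 1))‖ := by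
    rw [map_pow, norm_pow, norm_toCInf, inftyAbs_X]
    exact lt_self_pow₀ hq (Nat.one_lt_pow n.succ_ne_zero Fintype.one_lt_card)
  rw [map_sub, sub_eq_add_neg,
    IsUltrametricDist.norm_add_eq_max_of_norm_ne_norm (by rw [norm_neg]; exact norm_lt.ne'),
    norm_neg, max_eq_left norm_lt.le, map_pow, norm_pow, norm_toCInf, inftyAbs_X]

namespace DrinfeldModule

variable (φ : DrinfeldModule F s r)

theorem exists_norm_A_le : ∃ B : ℝ, 1 ≤ B ∧ ∀ i, ‖φ.A i‖ ≤ B := by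
  obtain ⟨B, hB⟩ := (φ.phiTheta.finite_support_coeff.image fun i => ‖φ.A i‖).bddAbove
  refine ⟨max 1 B, le_max_left _ _, fun i => ?_⟩
  by_cases hi : φ.A i = 0
  · simp [hi]
  · exact (hB ⟨i, hi, rfl⟩).trans (le_max_right _ _)

theorem eventually_norm_tauEval_phiTheta_le :
    ∀ᶠ f in 𝓝 0, ‖tauEval φ.phiTheta f‖ ≤ Fintype.card F * ‖f‖ := by
  have hq : (1 : ℝ) ≤ Fintype.card F := by exact_mod_cast Fintype.card_pos
  filter_upwards [(tauEval_sub_coeff_zero_mul_isLittleO φ.phiTheta).bound one_pos] with f hf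
  rw [one_mul, phiTheta, φ.coeff_zero] at hf
  have norm_theta_mul : ‖theta F s * f‖ = Fintype.card F * ‖f‖ := by
    simpa using norm_theta_pow_mul 1 f
  calc ‖tauEval φ.phiTheta f‖ = ‖(tauEval φ.phiTheta f - theta F s * f) + theta F s * f‖ := by
        rw [sub_add_cancel]
    _ ≤ max ‖f‖ ‖theta F s * f‖ :=
        (IsUltrametricDist.norm_add_le_max _ _).trans (max_le_max_right _ hf)
    _ = Fintype.card F * ‖f‖ := by
        rw [norm_theta_mul, max_eq_right (le_mul_of_one_le_left (norm_nonneg f) hq)]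

theorem mul_norm_A_mul_twist_le {B : ℝ} (hB : 1 ≤ B) (hA : ∀ i, ‖φ.A i‖ ≤ B) {k : ℕ} (hk : k ≠ 0)
    (f : Tate F s) :
    B * ‖φ.A k * twist (k : ℤ) f‖ ≤ (B * ‖f‖) ^ Fintype.card F ^ k := by
  have two_le : 2 ≤ Fintype.card F ^ k := Nat.one_lt_pow hk Fintype.one_lt_card
  calc B * ‖φ.A k * twist (k : ℤ) f‖ ≤ B * (B * ‖f‖ ^ Fintype.card F ^ k) := by
        grw [norm_mul_le, hA k, norm_twist]
    _ = B ^ 2 * ‖f‖ ^ Fintype.card F ^ k := by ring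
    _ ≤ B ^ Fintype.card F ^ k * ‖f‖ ^ Fintype.card F ^ k := by gcongr
    _ = (B * ‖f‖) ^ Fintype.card F ^ k := (mul_pow _ _ _).symm

theorem mul_norm_A_mul_twist_le_of_le {B l : ℝ} (hB : 1 ≤ B) (hA : ∀ i, ‖φ.A i‖ ≤ B) (hl₀ : 0 ≤ l)
    (hl₁ : l ≤ 1) (hl : 1 ≤ Fintype.card F * l ^ r) {i k : ℕ} (hk : k ≠ 0) {f : Tate F s}
    (hf : B * ‖f‖ ≤ (B * l ^ i) ^ Fintype.card F ^ i) :
    B * ‖φ.A k * twist (k : ℤ) f‖ ≤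
      (Fintype.card F * (B * l ^ (i + k))) ^ Fintype.card F ^ (i + k) := by
  set q := Fintype.card F
  rcases lt_or_ge r k with hr | hr
  · rw [A, phiTheta, φ.coeff_eq_zero_of_gt _ hr, zero_mul, norm_zero, mul_zero]
    positivity
  calc B * ‖φ.A k * twist (k : ℤ) f‖ ≤ (B * ‖f‖) ^ q ^ k := φ.mul_norm_A_mul_twist_le hB hA hk f
    _ ≤ ((B * l ^ i) ^ q ^ i) ^ q ^ k := by gcongr
    _ = (B * l ^ i * 1) ^ q ^ (i + k) := by rw [← pow_mul, ← pow_add, mul_one]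
    _ ≤ (B * l ^ i * (q * l ^ k)) ^ q ^ (i + k) := by
        gcongr
        exact hl.trans (by gcongr ?_ * ?_; exact pow_le_pow_of_le_one hl₀ hl₁ hr)
    _ = (q * (B * l ^ (i + k))) ^ q ^ (i + k) := by
        rw [pow_add l]
        ring

/- The denominator `θ ^ q ^ n - θ` of `α_n` gains a factor `q ≥ l⁻ʳ`, which pays for the at most `r`
steps from `α_{n - k}` to `α_n` in the recursion. -/
theorem mul_norm_expCoeff_le {B l : ℝ} (hB : 1 ≤ B) (hA : ∀ i, ‖φ.A i‖ ≤ B) (hl₀ : 0 ≤ l)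
    (hl₁ : l ≤ 1) (hl : 1 ≤ Fintype.card F * l ^ r) (n : ℕ) :
    B * ‖φ.expCoeff n‖ ≤ (B * l ^ n) ^ Fintype.card F ^ n := by
  set q := Fintype.card F
  have hq : (0 : ℝ) < q := by exact_mod_cast Fintype.card_pos
  induction n using Nat.strong_induction_on with
  | _ n ih =>
  cases n with
  | zero => simp [expCoeff]
  | succ n =>
    have term_le (i : ℕ) (hi : i < n + 1) :
        ‖φ.A (n + 1 - i) * twist (n + 1 - i : ℤ) (φ.expCoeff i)‖ ≤
          B⁻¹ * (q * (B * l ^ (n + 1))) ^ q ^ (n + 1) := by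
      have := φ.mul_norm_A_mul_twist_le_of_le hB hA hl₀ hl₁ hl (Nat.sub_ne_zero_of_lt hi) (ih i hi)
      rwa [Nat.add_sub_cancel' hi.le, Nat.cast_sub hi.le, Nat.cast_succ,
        ← le_inv_mul_iff₀ (by positivity)] at this
    rw [expCoeff, Tate.norm_const_mul, norm_inv, norm_toCInf_X_pow_card_pow_sub_X]
    calc _ ≤ B * (((q : ℝ) ^ q ^ (n + 1))⁻¹ * (B⁻¹ * (q * (B * l ^ (n + 1))) ^ q ^ (n + 1))) := by
          gcongr
          exact IsUltrametricDist.norm_sum_le_of_forall_le_of_nonneg (by positivity)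
            fun i _ => term_le i i.2
      _ = (B * l ^ (n + 1)) ^ q ^ (n + 1) := by
          rw [mul_pow (q : ℝ)]
          field_simp

theorem summable_norm_expCoeff_mul_pow (R : ℝ) :
    Summable fun n : ℕ => ‖φ.expCoeff n‖ * R ^ Fintype.card F ^ n := by
  obtain ⟨B, hB, hA⟩ := φ.exists_norm_A_le
  have hq : (1 : ℝ) < Fintype.card F := by exact_mod_cast Fintype.one_lt_card
  set l : ℝ := (Fintype.card F : ℝ)⁻¹ ^ (r : ℝ)⁻¹
  have hr : r ≠ 0 := Nat.one_le_iff_ne_zero.1 φ.rank_pos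
  have l_pow : l ^ r = (Fintype.card F : ℝ)⁻¹ := Real.rpow_inv_natCast_pow (by positivity) hr
  have l_nonneg : 0 ≤ l := by positivity
  have l_lt_one : l < 1 :=
    Real.rpow_lt_one (by positivity) (inv_lt_one_of_one_lt₀ hq) (by positivity)
  have one_le : 1 ≤ Fintype.card F * l ^ r := by rw [l_pow, mul_inv_cancel₀]; positivity
  have expCoeff_le (n : ℕ) : ‖φ.expCoeff n‖ ≤ (B * l ^ n) ^ Fintype.card F ^ n :=
    (le_mul_of_one_le_left (norm_nonneg _) hB).trans
      (φ.mul_norm_expCoeff_le hB hA l_nonneg l_lt_one.le one_le n)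
  have tendsto_zero : Tendsto (fun n => B * l ^ n * |R|) atTop (𝓝 0) := by
    have tendsto_l := tendsto_pow_atTop_nhds_zero_of_lt_one l_nonneg l_lt_one
    simpa using (tendsto_l.const_mul B).mul_const |R|
  refine Summable.of_norm_bounded_eventually_nat summable_geometric_two ?_
  filter_upwards [tendsto_zero.eventually (ge_mem_nhds one_half_pos)] with n hn
  calc ‖‖φ.expCoeff n‖ * R ^ Fintype.card F ^ n‖
      = ‖φ.expCoeff n‖ * |R| ^ Fintype.card F ^ n := by simp
    _ ≤ (B * l ^ n * |R|) ^ Fintype.card F ^ n := by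
        grw [expCoeff_le, ← mul_pow]
    _ ≤ (1 / 2) ^ Fintype.card F ^ n := by gcongr
    _ ≤ (1 / 2) ^ n := pow_le_pow_of_le_one (by norm_num) (by norm_num)
        (Nat.lt_pow_self Fintype.one_lt_card).le

theorem norm_expCoeff_mul_twist_le (f : Tate F s) (n : ℕ) :
    ‖φ.expCoeff n * twist (n : ℤ) f‖ ≤ ‖φ.expCoeff n‖ * ‖f‖ ^ Fintype.card F ^ n :=
  (norm_mul_le _ _).trans_eq (by rw [norm_twist])

theorem hasSum_exp (f : Tate F s) :
    HasSum (fun n : ℕ => φ.expCoeff n * twist (n : ℤ) f) (φ.exp f) :=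
  (Summable.of_norm_bounded (φ.summable_norm_expCoeff_mul_pow ‖f‖)
    (φ.norm_expCoeff_mul_twist_le f)).hasSum

theorem exp_theta_mul (f : Tate F s) : φ.exp (theta F s * f) = tauEval φ.phiTheta (φ.exp f) := by
  have expSeries_mul_theta := (φ.mul_theta_iff φ.expSeries (by simp [expSeries, expCoeff])).2 rfl
  refine HasSum.tsum_eq ?_
  have hasSum := hasSum_coeff_mul_twist_tauEval φ.phiTheta (E := φ.expSeries) (φ.hasSum_exp f)
  refine hasSum.congr_fun fun n => ?_
  rw [← expSeries_mul_theta, TwPoly.coeff_mul_const, map_mul, twist_natCast, ← mul_assoc]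
  rfl

theorem exp_sub_self_isLittleO : (fun f => φ.exp f - f) =o[𝓝 0] fun f => f := by
  have summable : Summable fun n : ℕ => ‖φ.expCoeff (n + 1)‖ := by
    simpa using (summable_nat_add_iff 1).2 (φ.summable_norm_expCoeff_mul_pow 1)
  refine Asymptotics.IsBigO.trans_isLittleO ?_ (Asymptotics.isLittleO_norm_pow_id one_lt_two)
  refine Asymptotics.IsBigO.of_bound (∑' n, ‖φ.expCoeff (n + 1)‖) ?_
  filter_upwards [Metric.closedBall_mem_nhds 0 one_pos] with f hf
  rw [mem_closedBall_zero_iff] at hf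
  have exp_sub_eq : φ.exp f - f = ∑' n : ℕ, φ.expCoeff (n + 1) * twist ((n + 1 : ℕ) : ℤ) f := by
    rw [exp, (φ.hasSum_exp f).summable.tsum_eq_zero_add, expCoeff, one_mul, Nat.cast_zero,
      twist_zero, add_sub_cancel_left]
  rw [exp_sub_eq, norm_pow, norm_norm]
  refine tsum_of_norm_bounded (summable.hasSum.mul_right _) fun n => ?_
  grw [φ.norm_expCoeff_mul_twist_le]
  gcongr ?_ * ?_
  exact pow_le_pow_of_le_one (norm_nonneg _) hf (Nat.one_lt_pow n.succ_ne_zero Fintype.one_lt_card)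

theorem tendsto_theta_pow_mul_exp {x : ℕ → Tate F s} {ξ : Tate F s}
    (hx : ∀ n, theta F s ^ n * x n = ξ) :
    Tendsto (fun n => theta F s ^ n * φ.exp (x n)) atTop (𝓝 ξ) := by
  have hq : (1 : ℝ) < Fintype.card F := by exact_mod_cast Fintype.one_lt_card
  have tendsto_x : Tendsto x atTop (𝓝 0) := by
    have norm_x (n : ℕ) : ‖x n‖ = ‖ξ‖ / (Fintype.card F : ℝ) ^ n := by
      rw [← hx n, norm_theta_pow_mul, mul_div_cancel_left₀]
      positivity
    rw [tendsto_zero_iff_norm_tendsto_zero]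
    simp_rw [norm_x]
    exact tendsto_const_nhds.div_atTop (tendsto_pow_atTop_atTop_of_one_lt hq)
  have scaled : (fun n => theta F s ^ n * (φ.exp (x n) - x n)) =o[atTop]
      fun n => theta F s ^ n * x n := by
    rw [← Asymptotics.isLittleO_norm_norm]
    simp_rw [norm_theta_pow_mul]
    exact (Asymptotics.isBigO_refl _ _).mul_isLittleO
      (φ.exp_sub_self_isLittleO.comp_tendsto tendsto_x).norm_norm
  simp_rw [mul_sub, hx] at scaled
  simpa using (scaled.norm_right.tendsto_zero_of_tendsto tendsto_const_nhds).add_const ξ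

theorem exp_eq_of_tower {d : ℕ → Tate F s} {ξ : Tate F s}
    (hd : ∀ n, tauEval φ.phiTheta (d (n + 1)) = d n)
    (hξ : Tendsto (fun n => theta F s ^ n * d n) atTop (𝓝 ξ)) : φ.exp ξ = d 0 := by
  have hq : (1 : ℝ) ≤ Fintype.card F := by exact_mod_cast Fintype.card_pos
  obtain ⟨u, hu⟩ := isUnit_theta (F := F) (s := s)
  let x (n : ℕ) : Tate F s := ↑(u⁻¹ ^ n) * ξ
  have theta_pow_mul_x (n : ℕ) : theta F s ^ n * x n = ξ := by
    simp only [x]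
    rw [← hu, inv_pow, ← Units.val_pow_eq_pow_val, Units.mul_inv_cancel_left]
  have theta_mul_x (n : ℕ) : theta F s * x (n + 1) = x n := by
    simp only [x]
    rw [← hu, pow_succ', Units.val_mul, mul_assoc, Units.mul_inv_cancel_left]
  have sub_tower (n : ℕ) :
      tauEval φ.phiTheta (φ.exp (x (n + 1)) - d (n + 1)) = φ.exp (x n) - d n := by
    rw [map_sub, ← exp_theta_mul, theta_mul_x, hd]
  have tendsto_sub : Tendsto (fun n => (Fintype.card F : ℝ) ^ n * ‖φ.exp (x n) - d n‖) atTop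
      (𝓝 0) := by
    simp_rw [← norm_theta_pow_mul, mul_sub]
    simpa using ((φ.tendsto_theta_pow_mul_exp theta_pow_mul_x).sub hξ).norm
  have := eq_zero_of_tower hq φ.eventually_norm_tauEval_phiTheta_le sub_tower tendsto_sub
  simpa [x, sub_eq_zero] using this

end DrinfeldModule

/-! ### The `z`-action -/

/-- The twist `σ = τ⁻¹` as a ring homomorphism, as needed to apply it to the coefficients of
polynomials and power series. -/
abbrev sigma : Tate F s →+* Tate F s := (twist (-1) : Tate F s ≃+* Tate F s)

theorem sigma_eq_inv_tau (c : Tate F s) : sigma c = (tau F s)⁻¹ c :=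
  (inv_tau_pow_apply 1 c).symm.trans (by rw [pow_one])

namespace DrinfeldModule

variable (φ : DrinfeldModule F s r)

theorem zAct_add (p q : (Tate F s)[X]) (m : SigmaPoly F s) :
    φ.zAct (p + q) m = φ.zAct p m + φ.zAct q m := by
  rw [zAct, map_add, LinearMap.add_apply]; rfl

theorem zAct_mul (p q : (Tate F s)[X]) (m : SigmaPoly F s) :
    φ.zAct (p * q) m = φ.zAct p (φ.zAct q m) := by
  rw [zAct, map_mul, Module.End.mul_apply]; rfl

theorem zAct_C (c : Tate F s) (m : SigmaPoly F s) : φ.zAct (.C c) m = c • m := by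
  rw [zAct, Polynomial.aeval_C, Module.algebraMap_end_apply]

theorem zAct_X (m : SigmaPoly F s) : φ.zAct .X m = m * starMap φ.phiTheta := by
  rw [zAct, Polynomial.aeval_X]; rfl

theorem zAct_zero (m : SigmaPoly F s) : φ.zAct 0 m = 0 := by
  rw [zAct, map_zero, LinearMap.zero_apply]

theorem zAct_sum {κ : Type*} (t : Finset κ) (p : κ → (Tate F s)[X]) (m : SigmaPoly F s) :
    φ.zAct (∑ i ∈ t, p i) m = ∑ i ∈ t, φ.zAct (p i) m := by
  simp only [zAct, map_sum, LinearMap.sum_apply]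

theorem zAct_map_sigma_gen_mul (p : (Tate F s)[X]) (m : SigmaPoly F s) :
    φ.zAct (p.map sigma) (TwPoly.gen _ * m) = TwPoly.gen _ * φ.zAct p m := by
  induction p using Polynomial.induction_on generalizing m with
  | C c => rw [Polynomial.map_C, zAct_C, zAct_C, TwPoly.gen_mul_smul, sigma_eq_inv_tau]
  | add p q hp hq => rw [Polynomial.map_add, zAct_add, zAct_add, hp, hq, mul_add]
  | monomial n c ih =>
    rw [pow_succ, ← mul_assoc, Polynomial.map_mul, Polynomial.map_X, zAct_mul, zAct_mul, zAct_X,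
      zAct_X, mul_assoc, ih]

theorem coeff_zero_zAct (p : (Tate F s)[X]) (m : SigmaPoly F s) :
    (φ.zAct p m).coeff 0 = p.eval (theta F s) * m.coeff 0 := by
  have coeff_zero_starMap : (starMap φ.phiTheta).coeff 0 = theta F s := by
    change twist (-((0 : ℕ) : ℤ)) (φ.A 0) = _
    rw [Nat.cast_zero, neg_zero, twist_zero, A, phiTheta, φ.coeff_zero]
  induction p using Polynomial.induction_on generalizing m with
  | C c => rw [zAct_C, TwPoly.coeff_smul, Polynomial.eval_C]
  | add p q hp hq => rw [zAct_add, TwPoly.coeff_add, hp, hq, Polynomial.eval_add, add_mul]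
  | monomial n c ih =>
    rw [pow_succ, ← mul_assoc, zAct_mul, zAct_X, ih, TwPoly.coeff_zero_mul, coeff_zero_starMap,
      Polynomial.eval_mul_X]
    ring

theorem iota_add (h k : Fin r → (Tate F s)[X]) : φ.iota (h + k) = φ.iota h + φ.iota k := by
  simp only [iota, Pi.add_apply, zAct_add, Finset.sum_add_distrib]

theorem iota_X_smul (h : Fin r → (Tate F s)[X]) :
    φ.iota ((.X : (Tate F s)[X]) • h) = φ.iota h * starMap φ.phiTheta := by
  simp only [iota, Pi.smul_apply, smul_eq_mul, zAct_mul, zAct_X, Finset.sum_mul]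

theorem iota_single (j : Fin r) (p : (Tate F s)[X]) :
    φ.iota (Pi.single j p) = φ.zAct p (TwPoly.gen _ ^ (j : ℕ)) := by
  rw [iota, Finset.sum_eq_single j _ (by simp), Pi.single_eq_same]
  intro i _ hi
  rw [Pi.single_eq_of_ne hi, zAct_zero]

theorem iota_map_sigma_vecMul_Phi (hA : IsUnit (φ.A r)) (h : Fin r → (Tate F s)[X]) :
    φ.iota (Matrix.vecMul (fun i => (h i).map sigma) φ.Phi) = TwPoly.gen _ * φ.iota h := by
  simp only [iota, Matrix.vecMul, dotProduct, zAct_sum, zAct_mul]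
  rw [Finset.sum_comm, Finset.mul_sum]
  refine Finset.sum_congr rfl fun i _ => ?_
  rw [← zAct_map_sigma_gen_mul, φ.Phi_spec hA]
  exact (map_sum (Polynomial.aeval (TwPoly.rightMul (starMap φ.phiTheta)) _) _ _).symm

theorem delta0_iota (h : Fin r → (Tate F s)[X]) :
    delta0 (φ.iota h) = (h ⟨0, φ.rank_pos⟩).eval (theta F s) := by
  rw [delta0, iota, TwPoly.coeff_sum, Finset.sum_eq_single ⟨0, φ.rank_pos⟩ _ (by simp)]
  · rw [coeff_zero_zAct, TwPoly.coeff_gen_pow, if_pos rfl, mul_one]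
  · intro i _ hi
    rw [coeff_zero_zAct, TwPoly.coeff_gen_pow, if_neg, mul_zero]
    exact fun h0 => hi (Fin.ext h0.symm)

theorem delta1_iota_single_C (c : Tate F s) :
    delta1 (φ.iota (Pi.single ⟨0, φ.rank_pos⟩ (.C c))) = c := by
  rw [iota_single, zAct_C, delta1_smul_gen_pow, Nat.cast_zero, twist_zero]

theorem eval_theta_Phi_zero (i : Fin r) : (φ.Phi i ⟨0, φ.rank_pos⟩).eval (theta F s) = 0 := by
  simp only [Phi, Matrix.of_apply]
  split_ifs <;> simp_all

theorem natDegree_Phi_le_one (i j : Fin r) : (φ.Phi i j).natDegree ≤ 1 := by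
  simp only [Phi, Matrix.of_apply]
  split_ifs <;> compute_degree <;> exact zero_le_one

theorem natDegree_Phi_of_ne_zero (i : Fin r) {j : Fin r} (hj : (j : ℕ) ≠ 0) :
    (φ.Phi i j).natDegree = 0 := by
  simp only [Phi, Matrix.of_apply, hj, if_false, ← Polynomial.C_neg, ← Polynomial.C_mul]
  split_ifs <;> first | exact Polynomial.natDegree_C _ | simp

theorem tauEval_delta1_iota (hA : IsUnit (φ.A r)) {h h' p : Fin r → (Tate F s)[X]}
    (heq : (.X : (Tate F s)[X]) • h' + Matrix.vecMul (fun i => (p i).map sigma) φ.Phi = h + p) :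
    tauEval φ.phiTheta (delta1 (φ.iota h')) = delta1 (φ.iota h) := by
  have := congrArg (fun v => delta1 (φ.iota v)) heq
  simp only [iota_add, delta1_add, iota_X_smul, φ.iota_map_sigma_vecMul_Phi hA, delta1_gen_mul,
    delta1_mul_starMap] at this
  exact add_right_cancel this

end DrinfeldModule

/-! ### Dividing the equation by powers of `z` -/

section FrobeniusEquation

variable {R : Type*} [CommRing R] {ι : Type*} [Fintype ι] {σ : R →+* R} {M : Matrix ι ι R[X]}
  {h : ι → R[X]} {g : ι → PowerSeries R}

variable (σ M h g) in
/-- `k` is the right-hand side of the equation `g^σ M - g = h` after its terms in the coefficients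
of `g` of degree below `n` have been moved into `h` and the equation has been divided by `z ^ n`. -/
def IsRemainder (n : ℕ) (k : ι → R[X]) : Prop :=
  (.X ^ n : R[X]) • k + Matrix.vecMul (fun j => (PowerSeries.trunc n (g j)).map σ) M =
    h + fun j => PowerSeries.trunc n (g j)

theorem exists_isRemainder
    (hg : Matrix.vecMul (fun j => PowerSeries.map σ (g j))
      (M.map fun p => (p : PowerSeries R)) - g = fun j => (h j : PowerSeries R)) (n : ℕ) :
    ∃ k, IsRemainder σ M h g n k := by
  suffices ∀ j, .X ^ n ∣ h j + PowerSeries.trunc n (g j) -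
      Matrix.vecMul (fun j => (PowerSeries.trunc n (g j)).map σ) M j by
    choose k hk using this
    exact ⟨k, funext fun j => sub_eq_iff_eq_add.1 (hk j) |>.symm⟩
  intro j
  rw [Polynomial.X_pow_dvd_iff]
  intro d hd
  have coeff_trunc_mul (i : ι) : ((PowerSeries.trunc n (g i)).map σ * M i j).coeff d =
      PowerSeries.coeff d (PowerSeries.map σ (g i) * (M i j : PowerSeries R)) := by
    rw [← PowerSeries.trunc_map, ← Polynomial.coeff_coe, Polynomial.coe_mul,
      ← PowerSeries.coeff_coe_trunc_of_lt hd, PowerSeries.trunc_trunc_mul,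
      PowerSeries.coeff_coe_trunc_of_lt hd]
  have coeff_h : (h j).coeff d = PowerSeries.coeff d
      (∑ i, PowerSeries.map σ (g i) * (M i j : PowerSeries R)) - PowerSeries.coeff d (g j) := by
    rw [← Polynomial.coeff_coe, ← congrFun hg j, Pi.sub_apply, map_sub]
    rfl
  rw [Polynomial.coeff_sub, Polynomial.coeff_add, coeff_h, PowerSeries.coeff_trunc, if_pos hd,
    Matrix.vecMul, dotProduct, Polynomial.finsetSum_coeff, map_sum]
  simp_rw [coeff_trunc_mul]
  ring

namespace IsRemainder

variable {n : ℕ} {k k' : ι → R[X]}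

theorem eq_of_zero (hk : IsRemainder σ M h g 0 k) : k = h := by
  have map_trunc : (fun j => (PowerSeries.trunc 0 (g j)).map σ) = 0 :=
    funext fun _ => Polynomial.map_zero σ
  rw [IsRemainder, map_trunc, Matrix.zero_vecMul, pow_zero, one_smul, add_zero] at hk
  exact hk.trans (add_zero h)

theorem X_smul_succ_add_vecMul (hk : IsRemainder σ M h g n k)
    (hk' : IsRemainder σ M h g (n + 1) k') :
    (.X : R[X]) • k' +
        Matrix.vecMul (fun j => (Polynomial.C (PowerSeries.coeff n (g j))).map σ) M =
      k + fun j => Polynomial.C (PowerSeries.coeff n (g j)) := by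
  have trunc_succ (j : ι) : PowerSeries.trunc (n + 1) (g j) =
      PowerSeries.trunc n (g j) + .X ^ n * .C (PowerSeries.coeff n (g j)) := by
    rw [PowerSeries.trunc_succ, ← Polynomial.C_mul_X_pow_eq_monomial, mul_comm]
  have map_trunc_succ : (fun j => (PowerSeries.trunc (n + 1) (g j)).map σ) =
      (fun j => (PowerSeries.trunc n (g j)).map σ) +
        (.X ^ n : R[X]) • fun j => (Polynomial.C (PowerSeries.coeff n (g j))).map σ := by
    ext1 j
    rw [trunc_succ, Polynomial.map_add, Polynomial.map_mul, Polynomial.map_pow, Polynomial.map_X]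
    rfl
  rw [IsRemainder, map_trunc_succ, Matrix.add_vecMul, Matrix.smul_vecMul] at hk'
  ext1 j
  have hkj := congrFun hk j
  have hkj' := congrFun hk' j
  simp only [Pi.add_apply, Pi.smul_apply, smul_eq_mul, trunc_succ] at hkj hkj' ⊢
  apply (Polynomial.monic_X_pow n).isRegular.left
  dsimp only
  linear_combination hkj' - hkj

theorem pow_mul_eval (hk : IsRemainder σ M h g n k) {x : R} {j : ι}
    (hM : ∀ i, (M i j).eval x = 0) :
    x ^ n * (k j).eval x =
      (h j).eval x + ∑ l ∈ Finset.range n, PowerSeries.coeff l (g j) * x ^ l := by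
  have eval_trunc : (PowerSeries.trunc n (g j)).eval x =
      ∑ l ∈ Finset.range n, PowerSeries.coeff l (g j) * x ^ l :=
    PowerSeries.eval₂_trunc_eq_sum_range x (RingHom.id R) n (g j)
  have := congrArg (Polynomial.eval x) (congrFun hk j)
  simpa [Matrix.vecMul, dotProduct, Polynomial.eval_finsetSum, hM, eval_trunc] using this

theorem coeff_eq_zero (hk : IsRemainder σ M h g n k) {j : ι} (hn : (h j).natDegree < n) {m : ℕ}
    (hM : ∀ i, (M i j).natDegree ≤ m) {l : ℕ} (hl : m ≤ l) : (k j).coeff l = 0 := by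
  obtain ⟨n, rfl⟩ := Nat.exists_eq_succ_of_ne_zero (Nat.ne_zero_of_lt hn)
  have coeff_term (i : ι) :
      ((PowerSeries.trunc (n + 1) (g i)).map σ * M i j).coeff (l + (n + 1)) = 0 := by
    refine Polynomial.coeff_eq_zero_of_natDegree_lt (Polynomial.natDegree_mul_le.trans_lt ?_)
    have := (Polynomial.natDegree_map_le (f := σ)).trans_lt (PowerSeries.natDegree_trunc_lt (g i) n)
    have := hM i
    omega
  have coeff_h : (h j).coeff (l + (n + 1)) = 0 :=
    Polynomial.coeff_eq_zero_of_natDegree_lt (hn.trans_le (Nat.le_add_left _ l))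
  have coeff_trunc : (PowerSeries.trunc (n + 1) (g j)).coeff (l + (n + 1)) = 0 := by
    rw [PowerSeries.coeff_trunc, if_neg (by omega)]
  have := congrArg (Polynomial.coeff · (l + (n + 1))) (congrFun hk j)
  simpa [Matrix.vecMul, dotProduct, Polynomial.coeff_X_pow_mul, coeff_term, coeff_h,
    coeff_trunc] using this

end IsRemainder

end FrobeniusEquation

namespace DrinfeldModule

variable (φ : DrinfeldModule F s r) {h : Fin r → (Tate F s)[X]} {g : Fin r → PowerSeries (Tate F s)}

theorem delta1_iota_of_isRemainder {n : ℕ} {k : Fin r → (Tate F s)[X]}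
    (hk : IsRemainder sigma φ.Phi h g n k) (hn : ∀ j, (h j).natDegree < n) :
    delta1 (φ.iota k) = (k ⟨0, φ.rank_pos⟩).eval (theta F s) := by
  have k_eq : k = Pi.single ⟨0, φ.rank_pos⟩ (.C ((k ⟨0, φ.rank_pos⟩).coeff 0)) := by
    ext j l
    rcases eq_or_ne j ⟨0, φ.rank_pos⟩ with rfl | hj
    · rw [Pi.single_eq_same, Polynomial.coeff_C]
      split_ifs with hl
      · rw [hl]
      · exact hk.coeff_eq_zero (hn _) (φ.natDegree_Phi_le_one · _) (Nat.one_le_iff_ne_zero.2 hl)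
    · rw [Pi.single_eq_of_ne hj, Polynomial.coeff_zero]
      exact hk.coeff_eq_zero (hn j)
        (fun i => (φ.natDegree_Phi_of_ne_zero i fun hj0 => hj (Fin.ext hj0)).le) l.zero_le
  rw [k_eq, delta1_iota_single_C, Pi.single_eq_same, Polynomial.eval_C]

end DrinfeldModule

/-! ### Evaluation at `z = θ` -/

theorem norm_coeff_mul_theta_pow (f : tateDisk F s) (n : ℕ) :
    ‖PowerSeries.coeff n f.1 * theta F s ^ n‖ = ‖theta F s‖ ^ n * ‖PowerSeries.coeff n f.1‖ := by
  rw [mul_comm, norm_theta_pow_mul, norm_theta]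

theorem summable_coeff_mul_theta_pow (f : tateDisk F s) :
    Summable fun n => PowerSeries.coeff n f.1 * theta F s ^ n := by
  refine NonarchimedeanAddGroup.summable_of_tendsto_cofinite_zero ?_
  rw [Nat.cofinite_eq_atTop, tendsto_zero_iff_norm_tendsto_zero]
  simp_rw [norm_coeff_mul_theta_pow]
  exact f.2

/-- The evaluation `∑ a_n zⁿ ↦ ∑ a_n θⁿ` on `𝕋_s{z/θ}`; by `delta0_iota` it is what `δ_0 ∘ ι`
extends to, on the first entry of a vector. -/
def evalTheta : tateDisk F s →+ Tate F s :=
  AddMonoidHom.mk' (fun f => ∑' n, PowerSeries.coeff n f.1 * theta F s ^ n) fun f g => by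
    rw [← (summable_coeff_mul_theta_pow f).tsum_add (summable_coeff_mul_theta_pow g)]
    exact tsum_congr fun n => add_mul _ _ _

theorem hasSum_evalTheta (f : tateDisk F s) :
    HasSum (fun n => PowerSeries.coeff n f.1 * theta F s ^ n) (evalTheta f) :=
  (summable_coeff_mul_theta_pow f).hasSum

theorem continuous_evalTheta : Continuous (evalTheta : tateDisk F s → Tate F s) := by
  refine AddMonoidHomClass.continuous_of_bound evalTheta 1 fun f => ?_
  rw [one_mul]
  refine le_of_tendsto (hasSum_evalTheta f).norm (.of_forall fun t => ?_)
  exact IsUltrametricDist.norm_sum_le_of_forall_le_of_nonneg (norm_nonneg f) fun n _ =>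
    (norm_coeff_mul_theta_pow f n).trans_le (le_ciSup (tateDisk_bddAbove f) n)

theorem evalTheta_polyToDisk (p : (Tate F s)[X]) :
    evalTheta (polyToDisk p) = p.eval (theta F s) := by
  have coeff_eq (n : ℕ) : PowerSeries.coeff n (polyToDisk p).1 = p.coeff n := p.coeff_coe n
  have := hasSum_evalTheta (polyToDisk p)
  simp_rw [coeff_eq] at this
  rw [Polynomial.eval_eq_sum_range]
  refine this.unique (hasSum_sum_of_ne_finset_zero fun n hn => ?_)
  rw [Polynomial.coeff_eq_zero_of_natDegree_lt (by simpa using hn), zero_mul]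

namespace DrinfeldModule

variable (φ : DrinfeldModule F s r)

theorem tendsto_delta0_iota (g : Fin r → tateDisk F s) :
    Tendsto (fun k => delta0 (φ.iota k)) (comap vecToDisk (𝓝 g))
      (𝓝 (evalTheta (g ⟨0, φ.rank_pos⟩))) := by
  have : Continuous fun g : Fin r → tateDisk F s => evalTheta (g ⟨0, φ.rank_pos⟩) :=
    continuous_evalTheta.comp (continuous_apply _)
  refine ((this.tendsto g).comp tendsto_comap).congr fun k => ?_
  rw [delta0_iota, ← evalTheta_polyToDisk]
  rfl

theorem D0_eq_evalTheta (g : Fin r → tateDisk F s) :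
    φ.D0 g = evalTheta (g ⟨0, φ.rank_pos⟩) :=
  have : (comap vecToDisk (𝓝 g)).NeBot :=
    comap_neBot_iff.2 fun _ ht => denseRange_vecToDisk.mem_nhds ht
  (φ.tendsto_delta0_iota g).limUnder_eq

theorem D0_add_vecToDisk (g : Fin r → tateDisk F s) (h : Fin r → (Tate F s)[X]) :
    φ.D0 (g + vecToDisk h) =
      evalTheta (g ⟨0, φ.rank_pos⟩) + (h ⟨0, φ.rank_pos⟩).eval (theta F s) := by
  rw [D0_eq_evalTheta, Pi.add_apply, map_add, vecToDisk, evalTheta_polyToDisk]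

end DrinfeldModule

end DrinfeldTate

end

theorem theorem4_general {F : Type*} [Field F] [Fintype F] {s r : ℕ} (φ : DrinfeldModule F s r)
    (hA : IsUnit (φ.A r)) {h : Fin r → (Tate F s)[X]} {g : Fin r → PowerSeries (Tate F s)}
    (hg : Matrix.vecMul (fun j => PowerSeries.map sigma (g j))
        (φ.Phi.map fun p => (p : PowerSeries (Tate F s))) - g =
      fun j => (h j : PowerSeries (Tate F s)))
    {η : Tate F s}
    (hη : HasSum (fun n => PowerSeries.coeff n (g ⟨0, φ.rank_pos⟩) * theta F s ^ n) η) :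
    HasSum (fun i : ℕ => φ.expCoeff i *
        twist (i : ℤ) (η + (h ⟨0, φ.rank_pos⟩).eval (theta F s))) (delta1 (φ.iota h)) := by
  choose k hk using exists_isRemainder hg
  let d (n : ℕ) : Tate F s := delta1 (φ.iota (k n))
  have d_zero : d 0 = delta1 (φ.iota h) := by simp only [d, (hk 0).eq_of_zero]
  have tower (n : ℕ) : tauEval φ.phiTheta (d (n + 1)) = d n :=
    φ.tauEval_delta1_iota hA ((hk n).X_smul_succ_add_vecMul (hk (n + 1)))
  have tendsto_d : Tendsto (fun n => theta F s ^ n * d n) atTop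
      (𝓝 (η + (h ⟨0, φ.rank_pos⟩).eval (theta F s))) := by
    rw [add_comm]
    refine (hη.tendsto_sum_nat.const_add _).congr' ?_
    filter_upwards [eventually_all.2 fun j => eventually_gt_atTop (h j).natDegree] with n hn
    simp only [d]
    rw [φ.delta1_iota_of_isRemainder (hk n) hn, (hk n).pow_mul_eval φ.eval_theta_Phi_zero]
  rw [← d_zero, ← φ.exp_eq_of_tower tower tendsto_d]
  exact φ.hasSum_exp _

theorem theorem4 {F : Type*} [Field F] [Fintype F] {s r : ℕ} (φ : DrinfeldModule F s r)
    (hA : IsUnit (φ.A r)) (h : Fin r → (Tate F s)[X]) (g : Fin r → tateDisk F s)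
    (hg : Matrix.vecMul
          (fun j => PowerSeries.map
            ((twist (-1) : Tate F s ≃+* Tate F s) : Tate F s →+* Tate F s) (g j).1)
          (φ.Phi.map fun p => (p : PowerSeries (Tate F s))) - (fun j => (g j).1) =
      fun j => (h j : PowerSeries (Tate F s))) :
    Tendsto (fun k => delta0 (φ.iota k)) (comap vecToDisk (𝓝 (g + vecToDisk h)))
        (𝓝 (φ.D0 (g + vecToDisk h))) ∧
    Summable (fun i : ℕ => φ.expCoeff i * twist (i : ℤ) (φ.D0 (g + vecToDisk h))) ∧
    φ.exp (φ.D0 (g + vecToDisk h)) = delta1 (φ.iota h) := by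
  have hasSum := theorem4_general φ hA hg (hasSum_evalTheta (g ⟨0, φ.rank_pos⟩))
  rw [← φ.D0_add_vecToDisk] at hasSum
  exact ⟨φ.D0_eq_evalTheta _ ▸ φ.tendsto_delta0_iota _, hasSum.summable, hasSum.tsum_eq⟩
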